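/- **Setting.** Let $E$ be a separable real Hilbert space and let $\mathcal D_{\rm source},\mathcal D_{\rm target}$ be distributions of $(\mathbf x,y)\in E\times\mathbb R$ with $\mathbb E\|\mathbf x\|^2<\infty$ and $\mathbb E y^2<\infty$. Put $\mathbf G=\mathbb E_{\rm source}[\mathbf x\mathbf x^\top]$ and $\mathbf H=\mathbb E_{\rm target}[\mathbf x\mathbf x^\top]$, both assumed strictly positive definite. Let $(\mu_j)$, $(\mathbf v_j)$ be the eigenvalues and an orthonormal eigenbasis of $\mathbf G$. For a set $J$ of indices write $\mathbf G_J=\sum_{j\in J}\mu_j\mathbf v_j\mathbf v_j^\top$, $\mathbf G_J^{-1}=\sum_{j\in J}\mu_j^{-1}\mathbf v_j\mathbf v_j^\top$, $\mathbf I_J=\sum_{j\in J}\mathbf v_j\mathbf v_j^\top$, and let $J^c$ be the complement of $J$. Write $\|\mathbf u\|_{\mathbf A}^2=\mathbf u^\top\mathbf A\mathbf u$. Let $R_{\rm source}(\mathbf w)=\tfrac12\mathbb E_{\rm source}(y-\langle\mathbf w,\mathbf x\rangle)^2$ and $R_{\rm target}(\mathbf w)=\tfrac12\mathbb E_{\rm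 target}(y-\langle\mathbf w,\mathbf x\rangle)^2$. Assume that $\mathbf w^*$ minimizes both risks, and let $\mathcal E(\mathbf w)=R_{\rm target}(\mathbf w)-R_{\rm target}(\mathbf w^*)$ be the target excess risk. **Algorithm.** Let $M>100$, $M_{\rm eff}=M/\log_2 M$, $\gamma>0$, and $\gamma_t=\gamma/2^{\lfloor t/M_{\rm eff}\rfloor}$ for $0\le t<M$. From an arbitrary $\mathbf w_0\in E$ run $$\mathbf w_t=\mathbf w_{t-1}-\gamma_{t-1}(\mathbf x_t\mathbf x_t^\top\mathbf w_{t-1}-\mathbf x_ty_t),\qquad t=1,\dots,M,$$ on independent samples $(\mathbf x_t,y_t)\sim\mathcal D_{\rm source}$ (no target data). **Assumptions.** For both distributions, with $\boldsymbol\Sigma=\mathbb E[\mathbf x\mathbf x^\top]$ (so $\boldsymbol\Sigma=\mathbf G$ for the source and $\boldsymbol\Sigma=\mathbf H$ for the target), $\mathbb E\|\mathbf x\|^4<\infty$, and with the same $\alpha>0$, $\sigma>0$: $\mathbb E[\mathbf x\mathbf x^\top\mathbf A\mathbf x\mathbf x^\top]\preceq\alpha\,\mathrm{tr}(\boldsymbol\Sigma\mathbf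 A)\,\boldsymbol\Sigma$ for every bounded positive semidefinite $\mathbf A$; and $\mathbb E[(y-\langle\mathbf w^*,\mathbf x\rangle)^2\mathbf x\mathbf x^\top]\preceq\sigma^2\boldsymbol\Sigma$ (with $\mathbb E[(y-\langle\mathbf w^*,\mathbf x\rangle)^2\|\mathbf x\|^2]<\infty$). Moreover $\gamma<1/(4\alpha\,\mathrm{tr}(\mathbf G))$. **Claim.** There are absolute constants $C,c>0$ such that the following holds. Put, for an index set $J$, $$D_{\rm eff}^{\rm pretrain}=\mathrm{tr}(\mathbf H\mathbf G_J^{-1})+M_{\rm eff}^2\gamma^2\,\mathrm{tr}(\mathbf H\mathbf G_{J^c})\in[0,\infty].$$ (1) For every index set $J$, $$\mathbb E\,\mathcal E(\mathbf w_M)\le C\Big[\Big\|\prod_{t=0}^{M-1}(\mathbf I-\gamma_t\mathbf G)(\mathbf w_0-\mathbf w^*)\Big\|_{\mathbf H}^2+\Big(\alpha\|\mathbf w_0-\mathbf w^*\|^2_{\frac{\mathbf I_J}{M_{\rm eff}\gamma}+\mathbf G_{J^c}}+\sigma^2\Big)\frac{D_{\rm eff}^{\rm pretrain}}{M_{\rm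 eff}}\Big].$$ (2) Suppose in addition that, for both distributions and some common $\beta>0$, $\mathbb E[\mathbf x\mathbf x^\top\mathbf A\mathbf x\mathbf x^\top]-\boldsymbol\Sigma\mathbf A\boldsymbol\Sigma\succeq\beta\,\mathrm{tr}(\boldsymbol\Sigma\mathbf A)\,\boldsymbol\Sigma$ for every bounded positive semidefinite $\mathbf A$, and that $y=\langle\mathbf w^*,\mathbf x\rangle+\epsilon$ with $\epsilon\sim\mathcal N(0,\sigma^2)$ independent of $\mathbf x$. Then for $J=\{j:\mu_j\ge 1/(\gamma M_{\rm eff})\}$, $$\mathbb E\,\mathcal E(\mathbf w_M)\ge c\Big[\Big\|\prod_{t=0}^{M-1}(\mathbf I-\gamma_t\mathbf G)(\mathbf w_0-\mathbf w^*)\Big\|_{\mathbf H}^2+\big(\beta\|\mathbf w_0-\mathbf w^*\|^2_{\mathbf G_{J^c}}+\sigma^2\big)\frac{D_{\rm eff}^{\rm pretrain}}{M_{\rm eff}}\Big].$$ -/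

import Mathlib

open MeasureTheory ProbabilityTheory
open scoped ENNReal NNReal RealInnerProductSpace

noncomputable section

namespace CovShift

/-! A data distribution is a probability measure on `E × ℝ`: a covariate `p.1` in a separable real
Hilbert space `E` together with a response `p.2`. -/

section Moments

variable {E : Type*} [NormedAddCommGroup E] [InnerProductSpace ℝ E] [MeasurableSpace E]

/-- The operator `x xᵀ`, that is `v ↦ ⟪x, v⟫ x`. -/
def outer (x : E) : E →L[ℝ] E := InnerProductSpace.rankOne ℝ x x

/-- The covariance operator `𝔼[x xᵀ]` of the covariate. -/
def secondMoment (D : Measure (E × ℝ)) : E →L[ℝ] E := ∫ p, outer p.1 ∂D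

/-- The operator `𝔼[x xᵀ A x xᵀ]`. -/
def fourthMoment (D : Measure (E × ℝ)) (A : E →L[ℝ] E) : E →L[ℝ] E :=
  ∫ p, outer p.1 ∘L A ∘L outer p.1 ∂D

/-- The risk `𝔼 (y - ⟪w, x⟫)² / 2` of a parameter `w`. -/
def risk (D : Measure (E × ℝ)) (w : E) : ℝ := (1 / 2) * ∫ p, (p.2 - ⟪w, p.1⟫) ^ 2 ∂D

/-- The excess risk of `w` relative to the minimizer `wStar`. -/
def excessRisk (D : Measure (E × ℝ)) (wStar w : E) : ℝ := risk D w - risk D wStar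

/-- The covariance has finite trace (`𝔼‖x‖² < ∞`), and the risks are finite (`𝔼 y² < ∞`). -/
structure FiniteSecondMoments (D : Measure (E × ℝ)) : Prop where
  covariate : Integrable (fun p : E × ℝ => ‖p.1‖ ^ 2) D
  response : Integrable (fun p : E × ℝ => p.2 ^ 2) D

/-- Strict positive definiteness of an operator. -/
def StrictlyPositive (T : E →L[ℝ] E) : Prop := ∀ v : E, v ≠ 0 → 0 < ⟪v, T v⟫

/-- A covariate shift problem for linear regression: source and target distributions with finite
second moments and positive definite covariances, and a parameter `wStar` that minimizes both
risks. -/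
structure IsCovariateShift (DS DT : Measure (E × ℝ)) (wStar : E) : Prop where
  source_moments : FiniteSecondMoments DS
  target_moments : FiniteSecondMoments DT
  source_pos : StrictlyPositive (secondMoment DS)
  target_pos : StrictlyPositive (secondMoment DT)
  source_min : ∀ w, risk DS wStar ≤ risk DS w
  target_min : ∀ w, risk DT wStar ≤ risk DT w

/-- Noise condition:
`𝔼[(y - ⟪wStar, x⟫)² x xᵀ] ≼ σ² 𝔼[x xᵀ]`, the left side being well defined. -/
structure NoiseBound (D : Measure (E × ℝ)) (wStar : E) (σ : ℝ) : Prop where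
  integrable : Integrable (fun p : E × ℝ => (p.2 - ⟪wStar, p.1⟫) ^ 2 * ‖p.1‖ ^ 2) D
  bound : ∫ p, (p.2 - ⟪wStar, p.1⟫) ^ 2 • outer p.1 ∂D ≤ σ ^ 2 • secondMoment D

/-- Well-specified noise: `y = ⟪wStar, x⟫ + ε` with `ε ∼ 𝒩(0, σ²)` independent of `x`. -/
structure WellSpecified (D : Measure (E × ℝ)) (wStar : E) (σ : ℝ) : Prop where
  gaussian : HasLaw (fun p : E × ℝ => p.2 - ⟪wStar, p.1⟫) (gaussianReal 0 (σ ^ 2).toNNReal) D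
  indep : IndepFun (fun p : E × ℝ => p.1) (fun p : E × ℝ => p.2 - ⟪wStar, p.1⟫) D

end Moments

section Trace

variable {E : Type*} [NormedAddCommGroup E] [InnerProductSpace ℝ E] [CompleteSpace E]

/-- The trace of a (trace class) operator, computed in some orthonormal Hilbert basis. -/
def trace (T : E →L[ℝ] E) : ℝ :=
  ∑' i : (exists_hilbertBasis ℝ E).choose,
    ⟪(exists_hilbertBasis ℝ E).choose_spec.choose i,
      T ((exists_hilbertBasis ℝ E).choose_spec.choose i)⟫

variable [MeasurableSpace E]

/-- Upper fourth moment condition: `𝔼[x xᵀ A x xᵀ] ≼ α tr(G A) G` for every PSD `A`, where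
`G = 𝔼[x xᵀ]`. -/
structure FourthMomentUpper (D : Measure (E × ℝ)) (α : ℝ) : Prop where
  integrable : Integrable (fun p : E × ℝ => ‖p.1‖ ^ 4) D
  bound : ∀ A : E →L[ℝ] E, A.IsPositive →
    fourthMoment D A ≤ (α * trace (secondMoment D ∘L A)) • secondMoment D

/-- Lower fourth moment condition: `β tr(G A) G ≼ 𝔼[x xᵀ A x xᵀ] - G A G` for every PSD `A`,
where `G = 𝔼[x xᵀ]`. -/
structure FourthMomentLower (D : Measure (E × ℝ)) (β : ℝ) : Prop where
  integrable : Integrable (fun p : E × ℝ => ‖p.1‖ ^ 4) D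
  bound : ∀ A : E →L[ℝ] E, A.IsPositive →
    (β * trace (secondMoment D ∘L A)) • secondMoment D ≤
      fourthMoment D A - secondMoment D ∘L A ∘L secondMoment D

end Trace

section Algorithm

variable {E : Type*} [NormedAddCommGroup E] [InnerProductSpace ℝ E]

/-- The effective number of samples `M / log₂ M`. -/
def effSamples (M : ℕ) : ℝ := M / Real.logb 2 M

/-- The geometrically decaying stepsizes: `γ` is halved after every `M / log₂ M` steps. -/
def stepsize (M : ℕ) (γ : ℝ) (t : ℕ) : ℝ := γ / 2 ^ ⌊(t : ℝ) / effSamples M⌋₊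

/-- The SGD iterates `w_{t+1} = w_t - γ_t (x xᵀ w_t - x y)`, where `(x, y) = z t` is the sample
used in the step from `w_t` to `w_{t+1}`. -/
def sgd (η : ℕ → ℝ) (w₀ : E) (z : ℕ → E × ℝ) : ℕ → E
  | 0 => w₀
  | t + 1 => sgd η w₀ z t - η t • (outer (z t).1 (sgd η w₀ z t) - (z t).2 • (z t).1)

/-- The operator `∏_{t < M} (I - γ_t G)`. -/
def contraction (η : ℕ → ℝ) (G : E →L[ℝ] E) (M : ℕ) : E →L[ℝ] E :=
  ((List.range M).map fun t => ContinuousLinearMap.id ℝ E - η t • G).prod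

/-- `‖u‖²_S = uᵀ S u`. -/
def sqNorm (S : E →L[ℝ] E) (u : E) : ℝ := ⟪u, S u⟫

end Algorithm

section Spectral

/-! The (possibly unbounded) operators `∑ⱼ φ j • v j (v j)ᵀ` with weights `φ j ≥ 0` along an
orthonormal basis `v` enter through two quantities with values in `[0, ∞]`. -/

variable {E : Type*} [NormedAddCommGroup E] [InnerProductSpace ℝ E] {ι : Type*}

/-- `‖u‖²_S = uᵀ S u` for `S = ∑ⱼ φ j • v j (v j)ᵀ`. -/
def weightedSq (v : HilbertBasis ι ℝ E) (φ : ι → ℝ) (u : E) : ℝ≥0∞ :=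
  ∑' j, ENNReal.ofReal (φ j * ⟪v j, u⟫ ^ 2)

/-- `tr(H S) = ∑ⱼ φ j (v j)ᵀ H (v j)` for `S = ∑ⱼ φ j • v j (v j)ᵀ` and a PSD operator `H`. -/
def weightedTrace (v : HilbertBasis ι ℝ E) (φ : ι → ℝ) (H : E →L[ℝ] E) : ℝ≥0∞ :=
  ∑' j, ENNReal.ofReal (φ j * ⟪v j, H (v j)⟫)

/-- Spectral weights of `G_J⁻¹`, where `μ` lists the eigenvalues of `G`. -/
def headInv (μ : ι → ℝ) (J : Set ι) : ι → ℝ := J.indicator fun j => (μ j)⁻¹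

/-- Spectral weights of `G_{Jᶜ}`, where `μ` lists the eigenvalues of `G`. -/
def tail (μ : ι → ℝ) (J : Set ι) : ι → ℝ := Jᶜ.indicator μ

/-- Spectral weights of `a I_J + G_{Jᶜ}`, where `μ` lists the eigenvalues of `G`. -/
def headConstTail (a : ℝ) (μ : ι → ℝ) (J : Set ι) : ι → ℝ :=
  fun j => J.indicator (fun _ => a) j + tail μ J j

/-- The effective dimension `tr(H G_J⁻¹) + m² γ² tr(H G_{Jᶜ})` of pretraining with effective
sample number `m`. -/
def effDim (v : HilbertBasis ι ℝ E) (μ : ι → ℝ) (J : Set ι) (H : E →L[ℝ] E) (m γ : ℝ) : ℝ≥0∞ :=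
  weightedTrace v (headInv μ J) H +
    ENNReal.ofReal (m ^ 2 * γ ^ 2) * weightedTrace v (tail μ J) H

end Spectral

end CovShift

end

/-!
Write `u_t = w_t - w*` and, for a covariance `A`, let `e_t(A) = 𝔼 ‖u_t‖²_A`. Since `w*` minimizes
the source risk, the cross terms vanish, and one step of SGD turns `e_{t+1}(A)` into
`e_t((I - γ_t G) A (I - γ_t G))` plus `γ_t² tr(G A)` times a noise level that the moment conditions
squeeze between multiples of `α e_t(G) + σ²` and `β e_t(G) + σ²`. Unrolling this recursion with
`A = H` leaves the bias `‖∏ (I - γ_t G) u_0‖²_H` and, in the eigenbasis of `G`, a sum over `j` of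
`⟪v_j, H v_j⟫` with coefficients that depend on `μ_j` only.

The noise levels satisfy a discrete Volterra inequality, which is solved by unrolling the same
recursion with `A = G`: in weighted sum and up to the factor `γ m`, with `m = M / log₂ M`, they are
of order `α ‖u_0‖² + σ²`. Finally, each coefficient is comparable to `1 / (m μ_j)` if `γ m μ_j ≥ 1`
and to `m γ² μ_j` otherwise: the noise injected while `γ_t` is about `1 / (m μ_j)` is not
contracted by the later, geometrically smaller steps. These are the weights of the effective
dimension, divided by `m`.
-/

noncomputable section

namespace CovShift

section Decay

/-- The factor `∏_{s ≤ k < t} (1 - η_k μ)` by which an eigendirection with eigenvalue `μ` is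
contracted between times `s` and `t`. -/
def decay (η : ℕ → ℝ) (μ : ℝ) (s t : ℕ) : ℝ := ∏ k ∈ Finset.Ico s t, (1 - η k * μ)

variable {η : ℕ → ℝ} {μ : ℝ} {s t n : ℕ}

lemma decay_self (η : ℕ → ℝ) (μ : ℝ) (s : ℕ) : decay η μ s s = 1 := by simp [decay]

lemma decay_succ (η : ℕ → ℝ) (μ : ℝ) (h : s ≤ t) :
    decay η μ s (t + 1) = decay η μ s t * (1 - η t * μ) := Finset.prod_Ico_succ_top h _

lemma decay_nonneg (h1 : ∀ k, η k * μ ≤ 1) (s t : ℕ) : 0 ≤ decay η μ s t :=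
  Finset.prod_nonneg fun k _ => sub_nonneg.2 (h1 k)

lemma decay_antitone (h0 : ∀ k, 0 ≤ η k * μ) (h1 : ∀ k, η k * μ ≤ 1) (s : ℕ) :
    Antitone (decay η μ s) := fun _ _ htt' =>
  Finset.prod_le_prod_of_subset_of_le_one (Finset.Ico_subset_Ico le_rfl htt')
    (fun k _ => sub_nonneg.2 (h1 k)) fun k _ _ => sub_le_self _ (h0 k)

lemma decay_le_one (h0 : ∀ k, 0 ≤ η k * μ) (h1 : ∀ k, η k * μ ≤ 1) (s t : ℕ) :
    decay η μ s t ≤ 1 :=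
  Finset.prod_le_one (fun k _ => sub_nonneg.2 (h1 k)) fun k _ => sub_le_self _ (h0 k)

lemma decay_sq_le (h0 : ∀ k, 0 ≤ η k * μ) (h1 : ∀ k, η k * μ ≤ 1) (s t : ℕ) :
    decay η μ s t ^ 2 ≤ decay η μ s t :=
  pow_le_of_le_one (decay_nonneg h1 s t) (decay_le_one h0 h1 s t) two_ne_zero

lemma decay_sq_le_one (h0 : ∀ k, 0 ≤ η k * μ) (h1 : ∀ k, η k * μ ≤ 1) (s t : ℕ) :
    decay η μ s t ^ 2 ≤ 1 :=
  (decay_sq_le h0 h1 s t).trans (decay_le_one h0 h1 s t)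

lemma sum_mul_decay_succ_eq (η : ℕ → ℝ) (μ : ℝ) (n : ℕ) :
    ∑ t ∈ Finset.range n, η t * μ * decay η μ (t + 1) n = 1 - decay η μ 0 n := by
  induction n with
  | zero => simp [decay]
  | succ n ih =>
    have : ∑ t ∈ Finset.range n, η t * μ * decay η μ (t + 1) (n + 1) =
        (∑ t ∈ Finset.range n, η t * μ * decay η μ (t + 1) n) * (1 - η n * μ) := by
      rw [Finset.sum_mul]
      refine Finset.sum_congr rfl fun t ht => ?_
      rw [decay_succ _ _ (by simpa using ht)]; ring
    rw [Finset.sum_range_succ, this, ih, decay_self, decay_succ _ _ (Nat.zero_le n)]; ring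

lemma sum_mul_decay_succ_le_one (h1 : ∀ k, η k * μ ≤ 1) (n : ℕ) :
    ∑ t ∈ Finset.range n, η t * μ * decay η μ (t + 1) n ≤ 1 := by
  rw [sum_mul_decay_succ_eq]; linarith [decay_nonneg h1 0 n]

lemma sum_mul_decay_succ_sq_le_one (h0 : ∀ k, 0 ≤ η k * μ) (h1 : ∀ k, η k * μ ≤ 1) (n : ℕ) :
    ∑ t ∈ Finset.range n, η t * μ * decay η μ (t + 1) n ^ 2 ≤ 1 :=
  (Finset.sum_le_sum fun t _ => mul_le_mul_of_nonneg_left (decay_sq_le h0 h1 _ _) (h0 t)).trans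
    (sum_mul_decay_succ_le_one h1 n)

lemma sum_Ico_mul_decay_eq (η : ℕ → ℝ) (μ : ℝ) (hs : s ≤ n) :
    ∑ t ∈ Finset.Ico s n, η t * μ * decay η μ s t = 1 - decay η μ s n := by
  induction n, hs using Nat.le_induction with
  | base => simp [decay]
  | succ n hn ih => rw [Finset.sum_Ico_succ_top hn, ih, decay_succ _ _ hn]; ring

lemma sum_Ico_mul_decay_sq_le_one (h0 : ∀ k, 0 ≤ η k * μ) (h1 : ∀ k, η k * μ ≤ 1) (hs : s ≤ n) :
    ∑ t ∈ Finset.Ico s n, η t * μ * decay η μ s t ^ 2 ≤ 1 :=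
  calc _ ≤ ∑ t ∈ Finset.Ico s n, η t * μ * decay η μ s t :=
        Finset.sum_le_sum fun t _ => mul_le_mul_of_nonneg_left (decay_sq_le h0 h1 _ _) (h0 t)
    _ ≤ 1 := by rw [sum_Ico_mul_decay_eq _ _ hs]; linarith [decay_nonneg h1 s n]

lemma decay_le_exp (h1 : ∀ k, η k * μ ≤ 1) (s t : ℕ) :
    decay η μ s t ≤ Real.exp (-((∑ k ∈ Finset.Ico s t, η k) * μ)) := by
  rw [Finset.sum_mul, ← Finset.sum_neg_distrib, Real.exp_sum]
  exact Finset.prod_le_prod (fun k _ => sub_nonneg.2 (h1 k)) fun k _ => Real.one_sub_le_exp_neg _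

lemma exp_neg_two_mul_le_one_sub {x : ℝ} (h0 : 0 ≤ x) (h1 : x ≤ 1 / 2) :
    Real.exp (-(2 * x)) ≤ 1 - x := by
  rw [Real.exp_neg, inv_le_iff_one_le_mul₀ (Real.exp_pos _)]
  nlinarith [Real.add_one_le_exp (2 * x)]

lemma exp_le_decay (h0 : ∀ k, 0 ≤ η k * μ) (h2 : ∀ k, η k * μ ≤ 1 / 2) (s t : ℕ) :
    Real.exp (-(2 * ((∑ k ∈ Finset.Ico s t, η k) * μ))) ≤ decay η μ s t := by
  rw [Finset.sum_mul, Finset.mul_sum, ← Finset.sum_neg_distrib, Real.exp_sum]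
  exact Finset.prod_le_prod (fun k _ => (Real.exp_pos _).le) fun k _ =>
    exp_neg_two_mul_le_one_sub (h0 k) (h2 k)

lemma mul_exp_neg_le_one (x : ℝ) : x * Real.exp (-x) ≤ 1 :=
  (Real.mul_exp_neg_le_exp_neg_one x).trans (by simp)

lemma one_add_mul_exp_neg_le_one (x : ℝ) : (1 + x) * Real.exp (-x) ≤ 1 := by
  rw [Real.exp_neg, ← div_eq_mul_inv, div_le_one (Real.exp_pos _), add_comm]
  exact Real.add_one_le_exp x

lemma sum_Ico_mul_decay_succ_sq_le_half (h0 : ∀ k, 0 ≤ η k * μ) (h2 : ∀ k, η k * μ ≤ 1 / 2)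
    (hst : s < t) :
    (∑ k ∈ Finset.Ico s t, η k) * μ * decay η μ (s + 1) t ^ 2 ≤ 1 / 2 := by
  have h1 : ∀ k, η k * μ ≤ 1 := fun k => (h2 k).trans (by norm_num)
  set R := (∑ k ∈ Finset.Ico (s + 1) t, η k) * μ with hR
  have hR0 : 0 ≤ R := by rw [hR, Finset.sum_mul]; exact Finset.sum_nonneg fun k _ => h0 k
  have hsplit : (∑ k ∈ Finset.Ico s t, η k) * μ = η s * μ + R := by
    rw [Finset.sum_eq_sum_Ico_succ_bot hst, add_mul]
  calc _ ≤ (1 + 2 * R) / 2 * Real.exp (-R) ^ 2 := by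
        have := decay_nonneg h1 (s + 1) t
        gcongr
        · linarith [h2 s]
        · exact decay_le_exp h1 _ _
    _ = (1 + 2 * R) * Real.exp (-(2 * R)) / 2 := by
        rw [← Real.exp_nat_mul, Nat.cast_two, mul_neg]; ring
    _ ≤ 1 / 2 := by gcongr; exact one_add_mul_exp_neg_le_one _

end Decay

section Stepsize

variable {M t : ℕ} {γ μ : ℝ}

lemma one_le_logb_two (hM : 1 < M) : 1 ≤ Real.logb 2 M := by
  have hM' : (2 : ℝ) ≤ M := by exact_mod_cast hM
  rwa [Real.le_logb_iff_rpow_le one_lt_two (by linarith), Real.rpow_one]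

lemma div_effSamples (hM : 1 < M) : (M : ℝ) / effSamples M = Real.logb 2 M := by
  have := one_le_logb_two hM
  unfold effSamples; field_simp

lemma effSamples_nonneg (M : ℕ) : 0 ≤ effSamples M :=
  div_nonneg (Nat.cast_nonneg _)
    (div_nonneg (Real.log_natCast_nonneg _) (Real.log_nonneg one_le_two))

lemma effSamples_le (hM : 1 < M) : effSamples M ≤ M :=
  div_le_self (Nat.cast_nonneg _) (one_le_logb_two hM)

/-- The minimum of `x / log₂ x` over `x > 1` is `e log 2 ≈ 1.88`, attained at `x = e`. -/
lemma nine_fifths_lt_effSamples (hM : 1 < M) : 9 / 5 < effSamples M := by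
  have hlogb := one_le_logb_two hM
  have hlog2 := Real.log_two_gt_d9
  have he := Real.exp_one_gt_d9
  have hlog : Real.log M ≤ M / Real.exp 1 := by
    have := Real.log_le_sub_one_of_pos (show (0 : ℝ) < M / Real.exp 1 by positivity)
    rw [Real.log_div (by positivity) (by positivity), Real.log_exp] at this
    linarith
  have hlogb_le : Real.logb 2 M * (Real.exp 1 * Real.log 2) ≤ M := by
    rw [Real.logb, div_mul_eq_mul_div, ← mul_assoc, mul_div_cancel_right₀ _ (by linarith)]
    rwa [le_div_iff₀ (Real.exp_pos 1)] at hlog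
  have hconst : 9 / 5 < Real.exp 1 * Real.log 2 := by nlinarith
  rw [effSamples, lt_div_iff₀ (by linarith)]
  nlinarith

lemma effSamples_pos (hM : 1 < M) : 0 < effSamples M := by
  linarith [nine_fifths_lt_effSamples hM]

lemma half_effSamples_le_floor (hM : 1 < M) : effSamples M / 2 ≤ ⌊effSamples M⌋₊ := by
  have h1 : 1 ≤ effSamples M := by linarith [nine_fifths_lt_effSamples hM]
  have hfloor : (1 : ℝ) ≤ ⌊effSamples M⌋₊ := by exact_mod_cast (Nat.one_le_floor_iff _).2 h1
  linarith [Nat.lt_floor_add_one (effSamples M)]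

lemma stepsize_pos (hγ : 0 < γ) (t : ℕ) : 0 < stepsize M γ t := by
  unfold stepsize; positivity

lemma stepsize_antitone (hγ : 0 < γ) : Antitone (stepsize M γ) := by
  intro s t hst
  have := effSamples_nonneg M
  unfold stepsize
  gcongr
  norm_num

lemma stepsize_le (hγ : 0 < γ) (t : ℕ) : stepsize M γ t ≤ γ :=
  div_le_self hγ.le (one_le_pow₀ (by norm_num))

lemma stepsize_mul_nonneg (hγ : 0 < γ) (hμ : 0 ≤ μ) (k : ℕ) : 0 ≤ stepsize M γ k * μ :=
  mul_nonneg (stepsize_pos hγ k).le hμ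

lemma stepsize_mul_le {b : ℝ} (hγ : 0 < γ) (hμ : 0 ≤ μ) (hb : γ * μ ≤ b) (k : ℕ) :
    stepsize M γ k * μ ≤ b :=
  (mul_le_mul_of_nonneg_right (stepsize_le hγ k) hμ).trans hb

lemma stepsize_eq_of_phase {l : ℕ} (h1 : l * effSamples M ≤ t)
    (h2 : t < (l + 1) * effSamples M) : stepsize M γ t = γ / 2 ^ l := by
  have hm : 0 < effSamples M := by linarith
  have : ⌊(t : ℝ) / effSamples M⌋₊ = l := by
    rw [Nat.floor_eq_iff (by positivity), le_div_iff₀ hm, div_lt_iff₀ hm]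
    exact ⟨h1, h2⟩
  rw [stepsize, this]

lemma stepsize_eq_of_lt_effSamples (ht : t < effSamples M) : stepsize M γ t = γ := by
  simpa using stepsize_eq_of_phase (M := M) (γ := γ) (l := 0) (by simp) (by simpa using ht)

lemma half_stepsize_le {k : ℕ} (hγ : 0 < γ) (hk : k ≤ t + effSamples M) :
    stepsize M γ t / 2 ≤ stepsize M γ k := by
  have hm := effSamples_nonneg M
  have hfloor : ⌊(k : ℝ) / effSamples M⌋₊ ≤ ⌊(t : ℝ) / effSamples M⌋₊ + 1 := by
    rw [← Nat.floor_add_one (by positivity)]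
    refine Nat.floor_le_floor ((div_le_div_of_nonneg_right hk hm).trans ?_)
    rw [add_div]
    gcongr
    exact div_self_le_one _
  calc stepsize M γ t / 2 = γ / 2 ^ (⌊(t : ℝ) / effSamples M⌋₊ + 1) := by
        rw [stepsize, pow_succ, div_div]
    _ ≤ stepsize M γ k := by unfold stepsize; gcongr; norm_num

lemma two_rpow_le_two_mul_two_pow_floor (x : ℝ) : (2 : ℝ) ^ x ≤ 2 * 2 ^ ⌊x⌋₊ :=
  calc (2 : ℝ) ^ x ≤ (2 : ℝ) ^ ((⌊x⌋₊ + 1 : ℕ) : ℝ) :=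
        Real.rpow_le_rpow_of_exponent_le one_le_two (by exact_mod_cast (Nat.lt_floor_add_one x).le)
    _ = 2 * 2 ^ ⌊x⌋₊ := by rw [Real.rpow_natCast, pow_succ']

lemma stepsize_add_le (hγ : 0 < γ) (s t : ℕ) :
    stepsize M γ (s + t) ≤ stepsize M γ s * (2 * Real.exp (-(Real.log 2 / effSamples M)) ^ t) := by
  have hm := effSamples_nonneg M
  set m := effSamples M
  have hfloor : ⌊(s : ℝ) / m⌋₊ + ⌊(t : ℝ) / m⌋₊ ≤ ⌊((s + t : ℕ) : ℝ) / m⌋₊ := by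
    apply Nat.le_floor
    push_cast
    rw [add_div]
    exact add_le_add (Nat.floor_le (by positivity)) (Nat.floor_le (by positivity))
  have hexp : Real.exp (-(Real.log 2 / m)) ^ t = ((2 : ℝ) ^ ((t : ℝ) / m))⁻¹ := by
    rw [← Real.exp_nat_mul, Real.rpow_def_of_pos two_pos, ← Real.exp_neg]
    congr 1; ring
  calc γ / 2 ^ ⌊((s + t : ℕ) : ℝ) / m⌋₊ ≤ γ / 2 ^ (⌊(s : ℝ) / m⌋₊ + ⌊(t : ℝ) / m⌋₊) := by
        gcongr; norm_num
    _ = γ / 2 ^ ⌊(s : ℝ) / m⌋₊ * (2 * (2 * 2 ^ ⌊(t : ℝ) / m⌋₊)⁻¹) := by rw [pow_add]; field_simp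
    _ ≤ γ / 2 ^ ⌊(s : ℝ) / m⌋₊ * (2 * ((2 : ℝ) ^ ((t : ℝ) / m))⁻¹) := by
        gcongr; exact two_rpow_le_two_mul_two_pow_floor _
    _ = _ := by rw [hexp]; rfl

lemma geom_sum_exp_neg_le {x : ℝ} (hx : 0 < x) (n : ℕ) :
    ∑ k ∈ Finset.range n, Real.exp (-x) ^ k ≤ (1 + x) / x := by
  have hr0 := Real.exp_pos (-x)
  have hr : Real.exp (-x) * (1 + x) ≤ 1 := by
    rw [mul_comm]; exact one_add_mul_exp_neg_le_one x
  have hr1 : Real.exp (-x) < 1 := by simpa using hx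
  calc ∑ k ∈ Finset.range n, Real.exp (-x) ^ k = (1 - Real.exp (-x) ^ n) / (1 - Real.exp (-x)) := by
        rw [geom_sum_eq hr1.ne, ← neg_div_neg_eq, neg_sub, neg_sub]
    _ ≤ (1 + x) / x := by
        rw [div_le_div_iff₀ (by linarith) hx]
        nlinarith [pow_pos hr0 n]

lemma sum_Ico_stepsize_le (hM : 1 < M) (hγ : 0 < γ) (s n : ℕ) :
    ∑ k ∈ Finset.Ico s n, stepsize M γ k ≤ 4 * effSamples M * stepsize M γ s := by
  have hm := nine_fifths_lt_effSamples hM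
  set m := effSamples M
  have hlog := Real.log_two_gt_d9
  set x := Real.log 2 / m
  have hbound : (1 + x) / x ≤ 2 * m := by
    have hx : (1 + x) / x = 1 + m / Real.log 2 := by simp only [x]; field_simp; ring
    have hlog_inv : m / Real.log 2 ≤ 1.443 * m := by
      rw [div_le_iff₀ (by linarith)]; nlinarith
    linarith
  rw [Finset.sum_Ico_eq_sum_range]
  calc _ ≤ ∑ k ∈ Finset.range (n - s), stepsize M γ s * (2 * Real.exp (-x) ^ k) :=
        Finset.sum_le_sum fun k _ => stepsize_add_le hγ s k
    _ = stepsize M γ s * 2 * ∑ k ∈ Finset.range (n - s), Real.exp (-x) ^ k := by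
        rw [Finset.mul_sum]; exact Finset.sum_congr rfl fun _ _ => by ring
    _ ≤ stepsize M γ s * 2 * (2 * m) := by
        have := stepsize_pos (M := M) hγ s
        gcongr
        exact (geom_sum_exp_neg_le (by positivity) _).trans hbound
    _ = _ := by ring

lemma sum_range_stepsize_le (hM : 1 < M) (hγ : 0 < γ) (n : ℕ) :
    ∑ k ∈ Finset.range n, stepsize M γ k ≤ 4 * γ * effSamples M := by
  have hm := effSamples_nonneg M
  calc ∑ k ∈ Finset.range n, stepsize M γ k ≤ 4 * effSamples M * stepsize M γ 0 := by
        rw [Finset.range_eq_Ico]; exact sum_Ico_stepsize_le hM hγ 0 n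
    _ ≤ 4 * effSamples M * γ := by gcongr; exact stepsize_le hγ 0
    _ = _ := by ring

lemma mul_effSamples_le_sum_stepsize (hγ : 0 < γ) (ht : effSamples M ≤ t) :
    γ * effSamples M ≤ ∑ k ∈ Finset.range t, stepsize M γ k :=
  calc γ * effSamples M ≤ ∑ _k ∈ Finset.range ⌈effSamples M⌉₊, γ := by
        simp only [Finset.sum_const, Finset.card_range, nsmul_eq_mul]
        rw [mul_comm]; gcongr; exact Nat.le_ceil _
    _ = ∑ k ∈ Finset.range ⌈effSamples M⌉₊, stepsize M γ k :=
        Finset.sum_congr rfl fun _ hk =>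
          (stepsize_eq_of_lt_effSamples (by simpa [Nat.lt_ceil] using hk)).symm
    _ ≤ _ := Finset.sum_le_sum_of_subset_of_nonneg
        (Finset.range_subset_range.2 (Nat.ceil_le.2 ht)) fun k _ _ => (stepsize_pos hγ k).le

lemma mul_stepsize_le_sum_Ico_stepsize {n : ℕ} (hM : 1 < M) (hγ : 0 < γ)
    (hn : t + ⌊effSamples M⌋₊ < n) :
    effSamples M / 4 * stepsize M γ t ≤ ∑ k ∈ Finset.Ico (t + 1) n, stepsize M γ k := by
  have hfl := half_effSamples_le_floor hM
  have hk : ∀ k ∈ Finset.Ico (t + 1) (t + 1 + ⌊effSamples M⌋₊),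
      stepsize M γ t / 2 ≤ stepsize M γ k := fun k hk => by
    refine half_stepsize_le hγ ?_
    have : (k : ℝ) ≤ t + ⌊effSamples M⌋₊ := by
      rw [Finset.mem_Ico] at hk; exact_mod_cast (by omega : k ≤ t + ⌊effSamples M⌋₊)
    linarith [Nat.floor_le (effSamples_nonneg M)]
  calc effSamples M / 4 * stepsize M γ t ≤ ⌊effSamples M⌋₊ * (stepsize M γ t / 2) := by
        nlinarith [stepsize_pos (M := M) hγ t]
    _ = ∑ k ∈ Finset.Ico (t + 1) (t + 1 + ⌊effSamples M⌋₊), stepsize M γ t / 2 := by simp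
    _ ≤ ∑ k ∈ Finset.Ico (t + 1) (t + 1 + ⌊effSamples M⌋₊), stepsize M γ k :=
        Finset.sum_le_sum hk
    _ ≤ _ := Finset.sum_le_sum_of_subset_of_nonneg
        (Finset.Ico_subset_Ico le_rfl (by omega)) fun k _ _ => (stepsize_pos hγ k).le

lemma stepsize_le_of_last_phase (hM : 1 < M) (hγ : 0 < γ) (ht : M ≤ t + effSamples M) :
    stepsize M γ t ≤ 4 * γ / M := by
  have hm := effSamples_pos hM
  have hfloor : Real.logb 2 M - 2 ≤ ⌊(t : ℝ) / effSamples M⌋₊ := by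
    have : (M : ℝ) / effSamples M ≤ t / effSamples M + 1 := by
      rw [div_add_one hm.ne']; gcongr
    rw [div_effSamples hM] at this
    linarith [Nat.lt_floor_add_one ((t : ℝ) / effSamples M)]
  have hpow : (M : ℝ) / 4 ≤ 2 ^ ⌊(t : ℝ) / effSamples M⌋₊ :=
    calc (M : ℝ) / 4 = 2 ^ (Real.logb 2 M - 2) := by
          rw [Real.rpow_sub two_pos, Real.rpow_logb two_pos (by norm_num) (by positivity)]
          norm_num
      _ ≤ 2 ^ (⌊(t : ℝ) / effSamples M⌋₊ : ℝ) :=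
          Real.rpow_le_rpow_of_exponent_le one_le_two hfloor
      _ = _ := Real.rpow_natCast _ _
  calc stepsize M γ t ≤ γ / (M / 4) := by unfold stepsize; gcongr
    _ = _ := by field_simp

lemma stepsize_mul_decay_le (hM : 1 < M) (hγ : 0 < γ) (hμ : 0 ≤ μ) (hγμ : γ * μ ≤ 1) (t : ℕ) :
    stepsize M γ t * μ * decay (stepsize M γ) μ (t + 1) M ≤ 4 / effSamples M := by
  have hm := effSamples_pos hM
  have hu0 := stepsize_mul_nonneg (M := M) hγ hμ
  have hu1 := stepsize_mul_le (M := M) hγ hμ hγμ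
  by_cases htM : t + ⌊effSamples M⌋₊ < M
  · set y := effSamples M / 4 * (stepsize M γ t * μ)
    have hdecay : decay (stepsize M γ) μ (t + 1) M ≤ Real.exp (-y) := by
      refine (decay_le_exp hu1 _ _).trans (Real.exp_le_exp.2 (neg_le_neg ?_))
      simp only [y]
      rw [← mul_assoc]
      exact mul_le_mul_of_nonneg_right (mul_stepsize_le_sum_Ico_stepsize hM hγ htM) hμ
    calc _ ≤ stepsize M γ t * μ * Real.exp (-y) := mul_le_mul_of_nonneg_left hdecay (hu0 t)
      _ = 4 / effSamples M * (y * Real.exp (-y)) := by simp only [y]; field_simp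
      _ ≤ 4 / effSamples M := mul_le_of_le_one_right (by positivity) (mul_exp_neg_le_one y)
  · have hlast : (M : ℝ) ≤ t + effSamples M := by
      have : (M : ℝ) ≤ t + ⌊effSamples M⌋₊ := by exact_mod_cast not_lt.1 htM
      linarith [Nat.floor_le hm.le]
    calc _ ≤ stepsize M γ t * μ := mul_le_of_le_one_right (hu0 t) (decay_le_one hu0 hu1 _ _)
      _ ≤ 4 * γ / M * μ := by gcongr; exact stepsize_le_of_last_phase hM hγ hlast
      _ = 4 * (γ * μ) / M := by ring
      _ ≤ 4 * 1 / effSamples M := by gcongr; exact effSamples_le hM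
      _ = _ := by rw [mul_one]

lemma exp_le_decay_sq (hM : 1 < M) (hγ : 0 < γ) (hμ : 0 ≤ μ) (hγμ : γ * μ ≤ 1 / 2)
    {c : ℝ} {s : ℕ} (hc : effSamples M * (stepsize M γ s * μ) ≤ c) (t : ℕ) :
    Real.exp (-(16 * c)) ≤ decay (stepsize M γ) μ s t ^ 2 := by
  have hsum := sum_Ico_stepsize_le hM hγ s t
  calc Real.exp (-(16 * c))
      ≤ Real.exp (-(2 * ((∑ k ∈ Finset.Ico s t, stepsize M γ k) * μ))) ^ 2 := by
        rw [← Real.exp_nat_mul]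
        apply Real.exp_le_exp.2
        push_cast
        nlinarith [mul_le_mul_of_nonneg_right hsum hμ]
    _ ≤ _ := by
        gcongr
        exact exp_le_decay (stepsize_mul_nonneg hγ hμ) (stepsize_mul_le hγ hμ hγμ) s t

end Stepsize

section NoiseGain

/-- The variance accumulated after `n` steps in an eigendirection with eigenvalue `μ` when noise of
covariance `q t` times the feature covariance is injected at step `t`. -/
def noiseGain (η q : ℕ → ℝ) (μ : ℝ) (n : ℕ) : ℝ :=
  ∑ t ∈ Finset.range n, η t ^ 2 * q t * (μ * decay η μ (t + 1) n ^ 2)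

variable {M : ℕ} {γ μ A B : ℝ} {q : ℕ → ℝ}

lemma noiseGain_le_of_sum_le (hγ : 0 < γ) (hμ : 0 ≤ μ) (hγμ : γ * μ ≤ 1) (hq : ∀ t, 0 ≤ q t)
    (hA : ∑ t ∈ Finset.range M, stepsize M γ t * q t ≤ A) :
    noiseGain (stepsize M γ) q μ M ≤ γ * μ * A :=
  calc noiseGain (stepsize M γ) q μ M
      ≤ ∑ t ∈ Finset.range M, γ * μ * (stepsize M γ t * q t) := by
        refine Finset.sum_le_sum fun t _ => ?_
        have hη := stepsize_pos (M := M) hγ t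
        have hq' := hq t
        calc _ = stepsize M γ t * μ * (stepsize M γ t * q t) *
              decay (stepsize M γ) μ (t + 1) M ^ 2 := by ring
          _ ≤ stepsize M γ t * μ * (stepsize M γ t * q t) :=
              mul_le_of_le_one_right (by positivity) (decay_sq_le_one
                (stepsize_mul_nonneg hγ hμ) (stepsize_mul_le hγ hμ hγμ) _ _)
          _ ≤ _ := by gcongr; exact stepsize_le hγ t
    _ = γ * μ * ∑ t ∈ Finset.range M, stepsize M γ t * q t := by rw [Finset.mul_sum]
    _ ≤ γ * μ * A := by gcongr

lemma noiseGain_term_le_of_lt_effSamples (hM : 1 < M) (hγ : 0 < γ) (hμ : 0 < μ) (hγμ : γ * μ ≤ 1)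
    {x : ℝ} (hx : 0 ≤ x) {t : ℕ} (ht : t < effSamples M) :
    stepsize M γ t ^ 2 * x * (μ * decay (stepsize M γ) μ (t + 1) M ^ 2) ≤
      16 / (γ * μ * effSamples M ^ 2) * (stepsize M γ t * x) := by
  have hm := effSamples_pos hM
  have hk := stepsize_mul_decay_le hM hγ hμ.le hγμ t
  have hd := decay_nonneg (stepsize_mul_le (M := M) hγ hμ.le hγμ) (t + 1) M
  rw [stepsize_eq_of_lt_effSamples ht] at hk ⊢
  set d := decay (stepsize M γ) μ (t + 1) M
  calc γ ^ 2 * x * (μ * d ^ 2) = γ * x / (γ * μ) * (γ * μ * d) ^ 2 := by field_simp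
    _ ≤ γ * x / (γ * μ) * (4 / effSamples M) ^ 2 := by gcongr
    _ = _ := by field_simp; norm_num

lemma noiseGain_term_le_of_effSamples_le (hM : 1 < M) (hγ : 0 < γ) (hμ : 0 < μ)
    (hγμ : γ * μ ≤ 1) {x : ℝ} (hx : 0 ≤ x) {t : ℕ} (ht : effSamples M ≤ t)
    (hB : (∑ k ∈ Finset.range t, stepsize M γ k) * x ≤ B) :
    stepsize M γ t ^ 2 * x * (μ * decay (stepsize M γ) μ (t + 1) M ^ 2) ≤
      4 * B / (γ * μ * effSamples M ^ 2) *
        (stepsize M γ t * μ * decay (stepsize M γ) μ (t + 1) M) := by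
  have hm := effSamples_pos hM
  have hk := stepsize_mul_decay_le hM hγ hμ.le hγμ t
  have hη := stepsize_pos (M := M) hγ t
  have hd := decay_nonneg (stepsize_mul_le (M := M) hγ hμ.le hγμ) (t + 1) M
  have hB0 : 0 ≤ B := le_trans (mul_nonneg
    (Finset.sum_nonneg fun k _ => (stepsize_pos hγ k).le) hx) hB
  have hxB : x ≤ B / (γ * effSamples M) := by
    rw [le_div_iff₀ (by positivity), mul_comm]
    exact (mul_le_mul_of_nonneg_right (mul_effSamples_le_sum_stepsize hγ ht) hx).trans hB
  set d := decay (stepsize M γ) μ (t + 1) M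
  calc stepsize M γ t ^ 2 * x * (μ * d ^ 2)
      = x / μ * (stepsize M γ t * μ * d) * (stepsize M γ t * μ * d) := by field_simp
    _ ≤ B / (γ * effSamples M) / μ * (4 / effSamples M) * (stepsize M γ t * μ * d) := by gcongr
    _ = _ := by field_simp

/-- The first `effSamples M` steps share the stepsize `γ`, so their noise is bounded through the
mean `A`; at later steps the elapsed time is at least `γ * effSamples M`, so the level itself is at
most `B / (γ * effSamples M)`. -/
lemma noiseGain_le_of_sum_mul_le (hM : 1 < M) (hγ : 0 < γ) (hμ : 0 < μ) (hγμ : γ * μ ≤ 1)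
    (hq : ∀ t, 0 ≤ q t) (hA : ∑ t ∈ Finset.range M, stepsize M γ t * q t ≤ A)
    (hB : ∀ t < M, (∑ k ∈ Finset.range t, stepsize M γ k) * q t ≤ B) :
    noiseGain (stepsize M γ) q μ M ≤ (16 * A + 4 * B) / (γ * μ * effSamples M ^ 2) := by
  have hη := fun t => (stepsize_pos (M := M) hγ t).le
  have hu1 := stepsize_mul_le (M := M) hγ hμ.le hγμ
  have hd := fun t => decay_nonneg hu1 (t + 1) M
  have hB0 : 0 ≤ B := by simpa using hB 0 (by omega)
  set z := γ * μ * effSamples M ^ 2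
  calc noiseGain (stepsize M γ) q μ M
      ≤ ∑ t ∈ Finset.range M, (16 / z * (stepsize M γ t * q t) +
          4 * B / z * (stepsize M γ t * μ * decay (stepsize M γ) μ (t + 1) M)) := by
        refine Finset.sum_le_sum fun t ht => ?_
        have hq' := hq t
        have hη' := hη t
        have hd' := hd t
        by_cases htm : (t : ℝ) < effSamples M
        · exact (noiseGain_term_le_of_lt_effSamples hM hγ hμ hγμ hq' htm).trans
            (le_add_of_nonneg_right (by positivity))
        · exact (noiseGain_term_le_of_effSamples_le hM hγ hμ hγμ hq' (not_lt.1 htm)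
            (hB t (Finset.mem_range.1 ht))).trans (le_add_of_nonneg_left (by positivity))
    _ = 16 / z * ∑ t ∈ Finset.range M, stepsize M γ t * q t + 4 * B / z *
          ∑ t ∈ Finset.range M, stepsize M γ t * μ * decay (stepsize M γ) μ (t + 1) M := by
        rw [Finset.sum_add_distrib, Finset.mul_sum, Finset.mul_sum]
    _ ≤ 16 / z * A + 4 * B / z * 1 := by
        gcongr
        exact sum_mul_decay_succ_le_one hu1 M
    _ = _ := by ring

lemma le_noiseGain_of_phase (hM : 1 < M) (hγ : 0 < γ) (hμ : 0 ≤ μ) (hγμ : γ * μ ≤ 1 / 2)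
    {κ c : ℝ} (hκ : 0 ≤ κ) (hq : ∀ t < M, κ ≤ q t) {l : ℕ} (hl : (l + 1) * effSamples M ≤ M)
    (hc : effSamples M * (γ / 2 ^ l * μ) ≤ c) :
    Real.exp (-(16 * c)) * κ * (effSamples M / 2 * (γ / 2 ^ l) ^ 2 * μ) ≤
      noiseGain (stepsize M γ) q μ M := by
  have hm := effSamples_nonneg M
  set m := effSamples M
  set s := ⌈l * m⌉₊
  have hphase : ∀ t ∈ Finset.Ico s (s + ⌊m⌋₊), stepsize M γ t = γ / 2 ^ l ∧ t < M := by
    intro t ht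
    rw [Finset.mem_Ico] at ht
    have hst : l * m ≤ t := Nat.ceil_le.1 ht.1
    have hts : t < (l + 1) * m := by
      have : (t : ℝ) + 1 ≤ s + ⌊m⌋₊ := by exact_mod_cast ht.2
      linarith [Nat.floor_le hm, Nat.ceil_lt_add_one (show 0 ≤ l * m by positivity)]
    exact ⟨stepsize_eq_of_phase hst hts, by exact_mod_cast hts.trans_le hl⟩
  have hterm : ∀ t ∈ Finset.Ico s (s + ⌊m⌋₊), (γ / 2 ^ l) ^ 2 * κ * (μ * Real.exp (-(16 * c))) ≤
      stepsize M γ t ^ 2 * q t * (μ * decay (stepsize M γ) μ (t + 1) M ^ 2) := by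
    intro t ht
    obtain ⟨hη, htM⟩ := hphase t ht
    have hη_succ := (stepsize_antitone (M := M) hγ (Nat.le_succ t)).trans_eq hη
    have hdecay := exp_le_decay_sq hM hγ hμ hγμ (c := c) (s := t + 1)
      (le_trans (by gcongr) hc) M
    rw [hη]
    have hκq := hq t htM
    have hq0 := hκ.trans hκq
    gcongr
  have hq0 : ∀ t < M, 0 ≤ q t := fun t ht => hκ.trans (hq t ht)
  calc _ = m / 2 * ((γ / 2 ^ l) ^ 2 * κ * (μ * Real.exp (-(16 * c)))) := by ring
    _ ≤ ⌊m⌋₊ * ((γ / 2 ^ l) ^ 2 * κ * (μ * Real.exp (-(16 * c)))) := by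
        gcongr; exact half_effSamples_le_floor hM
    _ = ∑ _t ∈ Finset.Ico s (s + ⌊m⌋₊), (γ / 2 ^ l) ^ 2 * κ * (μ * Real.exp (-(16 * c))) := by
        simp
    _ ≤ _ := Finset.sum_le_sum hterm
    _ ≤ _ := Finset.sum_le_sum_of_subset_of_nonneg
        (fun t ht => Finset.mem_range.2 (hphase t ht).2) fun t ht _ =>
        mul_nonneg (mul_nonneg (sq_nonneg _) (hq0 t (Finset.mem_range.1 ht)))
          (mul_nonneg hμ (sq_nonneg _))

lemma le_noiseGain_of_le_one (hM : 1 < M) (hγ : 0 < γ) (hμ : 0 ≤ μ) (hγμ : γ * μ ≤ 1 / 2)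
    {κ : ℝ} (hκ : 0 ≤ κ) (hq : ∀ t < M, κ ≤ q t) (h : γ * μ * effSamples M ≤ 1) :
    Real.exp (-16) / 2 * κ * (effSamples M * γ ^ 2 * μ) ≤ noiseGain (stepsize M γ) q μ M := by
  have := le_noiseGain_of_phase hM hγ hμ hγμ (c := 1) (l := 0) hκ hq
    (by simpa using effSamples_le hM) (by rw [pow_zero, div_one]; linarith)
  rw [pow_zero, div_one, mul_one] at this
  linarith

lemma exists_phase (hM : 1 < M) (hγμ : γ * μ ≤ 1 / 2) (h : 1 ≤ γ * μ * effSamples M) :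
    ∃ l : ℕ, (l + 1) * effSamples M ≤ M ∧ 1 ≤ effSamples M * (γ / 2 ^ l * μ) ∧
      effSamples M * (γ / 2 ^ l * μ) ≤ 2 := by
  have hm := effSamples_pos hM
  obtain ⟨l, hl, hl'⟩ := exists_nat_pow_near h one_lt_two
  have heq : effSamples M * (γ / 2 ^ l * μ) = γ * μ * effSamples M / 2 ^ l := by ring
  refine ⟨l, ?_, ?_, ?_⟩
  · have hpow : (2 : ℝ) ^ (l + 1) ≤ M :=
      le_trans (by rw [pow_succ]; nlinarith) (effSamples_le hM)
    have hlogb : ((l + 1 : ℕ) : ℝ) ≤ Real.logb 2 M := by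
      rwa [Real.le_logb_iff_rpow_le one_lt_two (by positivity), Real.rpow_natCast]
    rw [← le_div_iff₀ hm, div_effSamples hM]
    exact_mod_cast hlogb
  · rw [heq, one_le_div₀ (by positivity)]; exact hl
  · rw [heq, div_le_iff₀ (by positivity), ← pow_succ']; exact hl'.le

lemma le_noiseGain_of_one_le (hM : 1 < M) (hγ : 0 < γ) (hμ : 0 < μ) (hγμ : γ * μ ≤ 1 / 2)
    {κ : ℝ} (hκ : 0 ≤ κ) (hq : ∀ t < M, κ ≤ q t) (h : 1 ≤ γ * μ * effSamples M) :
    Real.exp (-32) / 2 * κ * (1 / (μ * effSamples M)) ≤ noiseGain (stepsize M γ) q μ M := by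
  have hm := effSamples_pos hM
  obtain ⟨l, hl, hl1, hl2⟩ := exists_phase hM hγμ h
  calc Real.exp (-32) / 2 * κ * (1 / (μ * effSamples M))
      ≤ Real.exp (-32) / 2 * κ *
          ((effSamples M * (γ / 2 ^ l * μ)) ^ 2 / (μ * effSamples M)) := by
        gcongr; exact one_le_pow₀ hl1
    _ = Real.exp (-(16 * 2)) * κ * (effSamples M / 2 * (γ / 2 ^ l) ^ 2 * μ) := by
        norm_num; field_simp
    _ ≤ _ := le_noiseGain_of_phase hM hγ hμ.le hγμ hκ hq hl hl2

end NoiseGain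

section Volterra

variable {M : ℕ} {γ α T Q : ℝ} {η q p : ℕ → ℝ} {K : ℕ → ℕ → ℝ}

/-- Integrating the Volterra inequality against `η` and exchanging the order of summation leaves at
most half of the unknown sum on the right. -/
lemma volterra_sum_le (hη : ∀ t, 0 ≤ η t) (hηγ : ∀ t, η t ≤ γ) (hα : 0 ≤ α) (hT0 : 0 ≤ T)
    (hT : 4 * α * γ * T ≤ 1) (hq : ∀ t, 0 ≤ q t)
    (hrec : ∀ s < M, q s ≤ p s + 2 * α * ∑ t ∈ Finset.range s, η t ^ 2 * q t * K t s)
    (hsum : ∑ t ∈ Finset.range M, η t * p t ≤ Q)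
    (hK : ∀ t < M, ∑ s ∈ Finset.Ico (t + 1) M, η s * K t s ≤ T) :
    ∑ t ∈ Finset.range M, η t * q t ≤ 2 * Q := by
  have hηq := fun t => mul_nonneg (hη t) (hq t)
  set S := ∑ t ∈ Finset.range M, η t * q t
  have hS0 : 0 ≤ S := Finset.sum_nonneg fun t _ => hηq t
  have hswap : ∑ s ∈ Finset.range M, ∑ t ∈ Finset.range s, η s * (η t ^ 2 * q t * K t s) =
      ∑ t ∈ Finset.range M, η t ^ 2 * q t * ∑ s ∈ Finset.Ico (t + 1) M, η s * K t s := by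
    rw [Finset.sum_comm' (s' := fun t => Finset.Ico (t + 1) M) (t' := Finset.range M)]
    · refine Finset.sum_congr rfl fun t _ => ?_
      rw [Finset.mul_sum]
      exact Finset.sum_congr rfl fun s _ => by ring
    · intro s t; simp only [Finset.mem_range, Finset.mem_Ico]; omega
  have hker : ∀ t ∈ Finset.range M,
      η t ^ 2 * q t * ∑ s ∈ Finset.Ico (t + 1) M, η s * K t s ≤ γ * T * (η t * q t) :=
    fun t ht => by
      have h := hηq t
      calc _ ≤ η t ^ 2 * q t * T := by
            have := hq t
            gcongr
            exact hK t (Finset.mem_range.1 ht)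
        _ = η t * T * (η t * q t) := by ring
        _ ≤ _ := by gcongr; exact hηγ t
  have hself : S ≤ Q + 2 * α * (γ * T * S) :=
    calc S ≤ ∑ s ∈ Finset.range M, η s * (p s + 2 * α *
            ∑ t ∈ Finset.range s, η t ^ 2 * q t * K t s) :=
          Finset.sum_le_sum fun s hs =>
            mul_le_mul_of_nonneg_left (hrec s (Finset.mem_range.1 hs)) (hη s)
      _ = ∑ s ∈ Finset.range M, η s * p s + 2 * α * ∑ s ∈ Finset.range M,
            ∑ t ∈ Finset.range s, η s * (η t ^ 2 * q t * K t s) := by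
          simp only [mul_add, Finset.sum_add_distrib, Finset.mul_sum]
          congr 1
          exact Finset.sum_congr rfl fun _ _ => Finset.sum_congr rfl fun _ _ => by ring
      _ ≤ Q + 2 * α * ∑ t ∈ Finset.range M, γ * T * (η t * q t) := by
          rw [hswap]
          exact add_le_add hsum
            (mul_le_mul_of_nonneg_left (Finset.sum_le_sum hker) (by positivity))
      _ = _ := by rw [← Finset.mul_sum]
  nlinarith

lemma volterra_term_le (hη : ∀ t, 0 ≤ η t) (hηγ : ∀ t, η t ≤ γ) (hq : ∀ t, 0 ≤ q t) {s t : ℕ}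
    (hts : t < s) {k a b : ℝ} (hk : 0 ≤ k) (hKt : (∑ r ∈ Finset.Ico t s, η r) * k ≤ a)
    (hqt : (∑ r ∈ Finset.range t, η r) * q t ≤ b) :
    (∑ r ∈ Finset.range s, η r) * (η t ^ 2 * q t * k) ≤
      γ * a * (η t * q t) + γ * b * (η t * k) := by
  have hηq := mul_nonneg (hη t) (hq t)
  have hb : 0 ≤ (∑ r ∈ Finset.range t, η r) * q t :=
    mul_nonneg (Finset.sum_nonneg fun r _ => hη r) (hq t)
  have ha : 0 ≤ (∑ r ∈ Finset.Ico t s, η r) * k :=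
    mul_nonneg (Finset.sum_nonneg fun r _ => hη r) hk
  have hγ0 : 0 ≤ γ := (hη t).trans (hηγ t)
  have hηt := hη t
  have hηγt := hηγ t
  calc _ = η t * (η t * q t) * ((∑ r ∈ Finset.Ico t s, η r) * k) +
        η t * (η t * k) * ((∑ r ∈ Finset.range t, η r) * q t) := by
        rw [← Finset.sum_range_add_sum_Ico _ hts.le]; ring
    _ ≤ γ * (η t * q t) * a + γ * (η t * k) * b := by gcongr
    _ = _ := by ring

lemma partialSum_mul_volterra_le (hη : ∀ t, 0 ≤ η t) (hηγ : ∀ t, η t ≤ γ) (hα : 0 ≤ α)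
    (hT : 4 * α * γ * T ≤ 1) (hq : ∀ t, 0 ≤ q t) (hK : ∀ t s, 0 ≤ K t s) (hQ : 0 ≤ Q)
    (hrec : ∀ s < M, q s ≤ p s + 2 * α * ∑ t ∈ Finset.range s, η t ^ 2 * q t * K t s)
    (hpt : ∀ s < M, (∑ k ∈ Finset.range s, η k) * p s ≤ Q)
    (hqsum : ∑ t ∈ Finset.range M, η t * q t ≤ 2 * Q)
    (hKsum : ∀ s, ∑ t ∈ Finset.range s, η t * K t s ≤ T)
    (hKpt : ∀ t s, t < s → (∑ k ∈ Finset.Ico t s, η k) * K t s ≤ T / 2) :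
    ∀ s < M, (∑ k ∈ Finset.range s, η k) * q s ≤ 3 * Q := by
  have hγ0 : 0 ≤ γ := (hη 0).trans (hηγ 0)
  have hT0 : 0 ≤ T := by simpa using hKsum 0
  intro s
  induction s using Nat.strong_induction_on with
  | _ s ih =>
  intro hs
  have hqsum_s : ∑ t ∈ Finset.range s, η t * q t ≤ 2 * Q :=
    (Finset.sum_le_sum_of_subset_of_nonneg (Finset.range_subset_range.2 hs.le)
      fun t _ _ => mul_nonneg (hη t) (hq t)).trans hqsum
  set Γ := ∑ k ∈ Finset.range s, η k
  have hΓ0 : 0 ≤ Γ := Finset.sum_nonneg fun k _ => hη k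
  calc Γ * q s ≤ Γ * (p s + 2 * α * ∑ t ∈ Finset.range s, η t ^ 2 * q t * K t s) := by
        gcongr; exact hrec s hs
    _ = Γ * p s + 2 * α * ∑ t ∈ Finset.range s, Γ * (η t ^ 2 * q t * K t s) := by
        rw [← Finset.mul_sum]; ring
    _ ≤ Q + 2 * α * ∑ t ∈ Finset.range s,
          (γ * (T / 2) * (η t * q t) + γ * (3 * Q) * (η t * K t s)) := by
        gcongr with t ht
        · exact hpt s hs
        · have hts := Finset.mem_range.1 ht
          exact volterra_term_le hη hηγ hq hts (hK t s) (hKpt t s hts) (ih t hts (hts.trans hs))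
    _ = Q + 2 * α * (γ * (T / 2) * ∑ t ∈ Finset.range s, η t * q t +
          γ * (3 * Q) * ∑ t ∈ Finset.range s, η t * K t s) := by
        rw [Finset.sum_add_distrib, Finset.mul_sum, Finset.mul_sum]
    _ ≤ Q + 2 * α * (γ * (T / 2) * (2 * Q) + γ * (3 * Q) * T) := by
        gcongr; exact hKsum s
    _ ≤ 3 * Q := by nlinarith

end Volterra

section SecondMoment

variable {E : Type*} [NormedAddCommGroup E] [InnerProductSpace ℝ E]

lemma outer_apply (x v : E) : outer x v = ⟪x, v⟫ • x := rfl

lemma inner_outer (u x v : E) : ⟪u, outer x v⟫ = ⟪x, u⟫ * ⟪x, v⟫ := by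
  rw [outer_apply, inner_smul_right, real_inner_comm x u, mul_comm]

lemma continuous_outer : Continuous (outer : E → E →L[ℝ] E) := by
  unfold outer
  exact ((InnerProductSpace.rankOne ℝ (E := E) (F := E)).continuous).clm_apply continuous_id

lemma norm_outer (x : E) : ‖outer x‖ = ‖x‖ ^ 2 := by
  rw [outer, InnerProductSpace.norm_rankOne, sq]

lemma abs_inner_apply_le (A : E →L[ℝ] E) (x y : E) : |⟪x, A y⟫| ≤ ‖A‖ * (‖x‖ * ‖y‖) :=
  (abs_real_inner_le_norm _ _).trans <|
    (mul_le_mul_of_nonneg_left (A.le_opNorm y) (norm_nonneg _)).trans_eq (by ring)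

lemma inner_apply_le_of_le {S T : E →L[ℝ] E} (h : S ≤ T) (u : E) : ⟪u, S u⟫ ≤ ⟪u, T u⟫ := by
  have := (ContinuousLinearMap.le_def S T).1 h |>.inner_nonneg_right u
  rw [sub_apply, inner_sub_right] at this
  linarith

lemma hasSum_inner_sq {ι : Type*} (b : HilbertBasis ι ℝ E) (x : E) :
    HasSum (fun i => ⟪x, b i⟫ ^ 2) (‖x‖ ^ 2) := by
  have h := b.hasSum_inner_mul_inner x x
  rw [real_inner_self_eq_norm_sq] at h
  refine h.congr_fun fun i => ?_
  rw [real_inner_comm x (b i), sq]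

lemma countable_of_hilbertBasis [SecondCountableTopology E] {ι : Type*}
    (b : HilbertBasis ι ℝ E) : Countable ι := by
  refine Pairwise.countable_of_isOpen_disjoint (s := fun i => Metric.ball (b i) (1 / 2)) ?_
    (fun i => Metric.isOpen_ball) fun i => ⟨b i, Metric.mem_ball_self (by norm_num)⟩
  intro i j hij
  refine Metric.ball_disjoint_ball ?_
  have hdist : ‖b i - b j‖ ^ 2 = 2 := by
    rw [@norm_sub_sq_real, b.orthonormal.1, b.orthonormal.1, b.orthonormal.2 hij]; norm_num
  rw [dist_eq_norm]
  nlinarith [norm_nonneg (b i - b j)]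

lemma integral_inner_apply [CompleteSpace E] {Ω : Type*} [MeasurableSpace Ω] {P : Measure Ω}
    {F : Ω → E →L[ℝ] E} (hF : Integrable F P) (u v : E) :
    ⟪u, (∫ ω, F ω ∂P) v⟫ = ∫ ω, ⟪u, F ω v⟫ ∂P := by
  rw [ContinuousLinearMap.integral_apply hF, ← integral_inner (hF.apply_continuousLinearMap v)]

variable [SecondCountableTopology E] [MeasurableSpace E] [BorelSpace E] {D : Measure (E × ℝ)}

lemma integrable_outer (h : Integrable (fun p : E × ℝ => ‖p.1‖ ^ 2) D) :
    Integrable (fun p : E × ℝ => outer p.1) D :=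
  h.mono (continuous_outer.comp continuous_fst).aestronglyMeasurable
    (.of_forall fun p => by simp [norm_outer])

lemma integrable_inner_mul_inner (h : Integrable (fun p : E × ℝ => ‖p.1‖ ^ 2) D) (u v : E) :
    Integrable (fun p : E × ℝ => ⟪p.1, u⟫ * ⟪p.1, v⟫) D := by
  simp_rw [← inner_outer]
  exact ((integrable_outer h).apply_continuousLinearMap v).const_inner u

variable [CompleteSpace E]

lemma inner_secondMoment (h : Integrable (fun p : E × ℝ => ‖p.1‖ ^ 2) D) (u v : E) :
    ⟪u, secondMoment D v⟫ = ∫ p, ⟪p.1, u⟫ * ⟪p.1, v⟫ ∂D := by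
  rw [secondMoment, integral_inner_apply (integrable_outer h)]
  simp_rw [inner_outer]

lemma secondMoment_isPositive (h : Integrable (fun p : E × ℝ => ‖p.1‖ ^ 2) D) :
    (secondMoment D).IsPositive := by
  rw [ContinuousLinearMap.isPositive_iff]
  refine ⟨fun u v => ?_, fun u => ?_⟩
  · change ⟪secondMoment D u, v⟫ = ⟪u, secondMoment D v⟫
    rw [real_inner_comm, inner_secondMoment h, inner_secondMoment h]
    simp_rw [mul_comm]
  · rw [real_inner_comm, inner_secondMoment h]
    exact integral_nonneg fun p => mul_self_nonneg _

lemma hasSum_inner_secondMoment_comp (h : Integrable (fun p : E × ℝ => ‖p.1‖ ^ 2) D)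
    (A : E →L[ℝ] E) {ι : Type*} (b : HilbertBasis ι ℝ E) :
    HasSum (fun i => ⟪b i, secondMoment D (A (b i))⟫) (∫ p, ⟪p.1, A p.1⟫ ∂D) := by
  have := countable_of_hilbertBasis b
  simp_rw [inner_secondMoment h]
  set B := ContinuousLinearMap.adjoint A
  have hB : ∀ x i, ⟪x, A (b i)⟫ = ⟪B x, b i⟫ := fun x i =>
    (ContinuousLinearMap.adjoint_inner_left A (b i) x).symm
  have hbound : ∀ x : E, HasSum (fun i => (⟪x, b i⟫ ^ 2 + ⟪B x, b i⟫ ^ 2) / 2)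
      ((‖x‖ ^ 2 + ‖B x‖ ^ 2) / 2) := fun x =>
    ((hasSum_inner_sq b x).add (hasSum_inner_sq b (B x))).div_const 2
  refine hasSum_integral_of_dominated_convergence
    (fun i p => (⟪p.1, b i⟫ ^ 2 + ⟪B p.1, b i⟫ ^ 2) / 2) (fun i => by fun_prop)
    (fun i => .of_forall fun p => ?_) (.of_forall fun p => (hbound p.1).summable) ?_
    (.of_forall fun p => ?_)
  · rw [hB, Real.norm_eq_abs, abs_le]
    constructor <;> nlinarith [sq_nonneg (⟪p.1, b i⟫ + ⟪B p.1, b i⟫),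
      sq_nonneg (⟪p.1, b i⟫ - ⟪B p.1, b i⟫)]
  · simp_rw [fun p : E × ℝ => (hbound p.1).tsum_eq]
    refine (h.const_mul ((1 + ‖B‖ ^ 2) / 2)).mono' (by fun_prop) (.of_forall fun p => ?_)
    rw [Real.norm_of_nonneg (by positivity)]
    have := pow_le_pow_left₀ (norm_nonneg _) (B.le_opNorm p.1) 2
    rw [mul_pow] at this
    linarith
  · have := b.hasSum_inner_mul_inner (B p.1) p.1
    rw [ContinuousLinearMap.adjoint_inner_left] at this
    refine this.congr_fun (fun i => ?_)
    rw [hB, real_inner_comm p.1 (b i), mul_comm]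

lemma trace_secondMoment_comp (h : Integrable (fun p : E × ℝ => ‖p.1‖ ^ 2) D)
    (A : E →L[ℝ] E) : trace (secondMoment D ∘L A) = ∫ p, ⟪p.1, A p.1⟫ ∂D :=
  (hasSum_inner_secondMoment_comp h A _).tsum_eq

lemma trace_secondMoment (h : Integrable (fun p : E × ℝ => ‖p.1‖ ^ 2) D) :
    trace (secondMoment D) = ∫ p, ‖p.1‖ ^ 2 ∂D := by
  simpa using trace_secondMoment_comp h (ContinuousLinearMap.id ℝ E)

end SecondMoment

section Congruence

variable {E : Type*} [NormedAddCommGroup E] [InnerProductSpace ℝ E] [CompleteSpace E]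

/-- The congruence `Tᵀ A T`, the operator of the quadratic form `u ↦ ⟪T u, A (T u)⟫`. -/
def congruence (T A : E →L[ℝ] E) : E →L[ℝ] E := ContinuousLinearMap.adjoint T ∘L A ∘L T

lemma inner_congruence (T A : E →L[ℝ] E) (u v : E) : ⟪u, congruence T A v⟫ = ⟪T u, A (T v)⟫ :=
  ContinuousLinearMap.adjoint_inner_right T u (A (T v))

lemma inner_congruence_id_sub_smul {A G : E →L[ℝ] E} (hA : A.IsPositive) (hG : G.IsPositive)
    (r : ℝ) (e : E) :
    ⟪e, congruence (ContinuousLinearMap.id ℝ E - r • G) A e⟫ =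
      ⟪e, A e⟫ - 2 * r * ⟪e, G (A e)⟫ + r ^ 2 * ⟪e, G (A (G e))⟫ := by
  have h1 : ⟪G e, A e⟫ = ⟪e, G (A e)⟫ := hG.inner_left_eq_inner_right _ _
  have h2 : ⟪e, A (G e)⟫ = ⟪e, G (A e)⟫ := by
    rw [← hA.inner_left_eq_inner_right, real_inner_comm, h1]
  have h3 : ⟪G e, A (G e)⟫ = ⟪e, G (A (G e))⟫ := hG.inner_left_eq_inner_right _ _
  simp only [inner_congruence, sub_apply, smul_apply, ContinuousLinearMap.id_apply, map_sub,
    map_smul, inner_sub_left, inner_sub_right, inner_smul_left, inner_smul_right, conj_trivial,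
    h1, h2, h3]
  ring

end Congruence

section IsSecondMoment

variable {E : Type*} [NormedAddCommGroup E] [InnerProductSpace ℝ E] [MeasurableSpace E]

/-- Operators that are themselves second moments. The energies tracked along SGD are quadratic
forms of such operators; the representation reduces the noise bound, an inequality between
quadratic forms, to its value at single vectors. -/
def IsSecondMoment (A : E →L[ℝ] E) : Prop :=
  ∃ D : Measure (E × ℝ), SFinite D ∧ Integrable (fun p : E × ℝ => ‖p.1‖ ^ 2) D ∧
    A = secondMoment D

lemma isSecondMoment_secondMoment {D : Measure (E × ℝ)} [SFinite D]
    (h : Integrable (fun p : E × ℝ => ‖p.1‖ ^ 2) D) : IsSecondMoment (secondMoment D) :=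
  ⟨D, inferInstance, h, rfl⟩

variable [CompleteSpace E] [BorelSpace E] [SecondCountableTopology E]

lemma IsSecondMoment.isPositive {A : E →L[ℝ] E} (hA : IsSecondMoment A) : A.IsPositive := by
  obtain ⟨D, -, h, rfl⟩ := hA
  exact secondMoment_isPositive h

lemma IsSecondMoment.congruence {A : E →L[ℝ] E} (hA : IsSecondMoment A) (T : E →L[ℝ] E) :
    IsSecondMoment (congruence T A) := by
  obtain ⟨D, _, h, rfl⟩ := hA
  set B := ContinuousLinearMap.adjoint T
  have hB : Measurable (Prod.map B id : E × ℝ → E × ℝ) := by fun_prop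
  have hmap : Integrable (fun p : E × ℝ => ‖p.1‖ ^ 2) (D.map (Prod.map B id)) := by
    rw [integrable_map_measure (Continuous.aestronglyMeasurable (by fun_prop))
      hB.aemeasurable]
    refine (h.const_mul (‖B‖ ^ 2)).mono' (by fun_prop) (.of_forall fun p => ?_)
    simp only [Function.comp_apply, Prod.map_fst]
    rw [Real.norm_of_nonneg (by positivity), ← mul_pow]
    exact pow_le_pow_left₀ (norm_nonneg _) (B.le_opNorm p.1) 2
  refine ⟨D.map (Prod.map B id), inferInstance, hmap,
    ContinuousLinearMap.ext fun u => ext_inner_left ℝ fun v => ?_⟩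
  rw [inner_congruence, inner_secondMoment h, inner_secondMoment hmap,
    integral_map hB.aemeasurable (Continuous.aestronglyMeasurable (by fun_prop))]
  simp only [Prod.map_fst, B, ContinuousLinearMap.adjoint_inner_left]

end IsSecondMoment

section Risk

variable {E : Type*} [NormedAddCommGroup E] [InnerProductSpace ℝ E]
  [SecondCountableTopology E] [MeasurableSpace E] [BorelSpace E]
  {D : Measure (E × ℝ)} {wStar : E}

lemma FiniteSecondMoments.integrable_residual_sq (h : FiniteSecondMoments D) (w : E) :
    Integrable (fun p : E × ℝ => (p.2 - ⟪w, p.1⟫) ^ 2) D := by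
  refine ((h.response.const_mul 2).add (h.covariate.const_mul (2 * ‖w‖ ^ 2))).mono'
    (by fun_prop) (.of_forall fun p => ?_)
  have hcs : ⟪w, p.1⟫ ^ 2 ≤ (‖w‖ * ‖p.1‖) ^ 2 :=
    sq_le_sq.2 ((abs_real_inner_le_norm _ _).trans (le_abs_self _))
  rw [Real.norm_of_nonneg (sq_nonneg _), Pi.add_apply]
  nlinarith [sq_nonneg (p.2 + ⟪w, p.1⟫)]

lemma FiniteSecondMoments.integrable_residual_mul (h : FiniteSecondMoments D) (w u : E) :
    Integrable (fun p : E × ℝ => (p.2 - ⟪w, p.1⟫) * ⟪p.1, u⟫) D := by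
  refine ((h.integrable_residual_sq w).add (h.covariate.const_mul (‖u‖ ^ 2))).mono'
    (by fun_prop) (.of_forall fun p => ?_)
  have hcs : ⟪p.1, u⟫ ^ 2 ≤ (‖p.1‖ * ‖u‖) ^ 2 :=
    sq_le_sq.2 ((abs_real_inner_le_norm _ _).trans (le_abs_self _))
  rw [Real.norm_eq_abs, abs_le, Pi.add_apply]
  constructor <;> nlinarith [sq_nonneg (p.2 - ⟪w, p.1⟫ + ⟪p.1, u⟫),
    sq_nonneg (p.2 - ⟪w, p.1⟫ - ⟪p.1, u⟫), sq_nonneg (p.2 - ⟪w, p.1⟫), sq_nonneg ⟪p.1, u⟫]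

variable [CompleteSpace E]

lemma FiniteSecondMoments.risk_add_sub_risk (h : FiniteSecondMoments D) (w u : E) :
    risk D (w + u) - risk D w =
      (1 / 2) * ⟪u, secondMoment D u⟫ - ∫ p, (p.2 - ⟪w, p.1⟫) * ⟪p.1, u⟫ ∂D := by
  have hsq := h.integrable_residual_sq w
  have hcross := (h.integrable_residual_mul w u).const_mul 2
  have hquad := integrable_inner_mul_inner h.covariate u u
  have hexpand : ∀ p : E × ℝ, (p.2 - ⟪w + u, p.1⟫) ^ 2 = (p.2 - ⟪w, p.1⟫) ^ 2 -
      2 * ((p.2 - ⟪w, p.1⟫) * ⟪p.1, u⟫) + ⟪p.1, u⟫ * ⟪p.1, u⟫ := fun p => by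
    rw [inner_add_left, real_inner_comm p.1 u]; ring
  have hdiff : Integrable (fun p : E × ℝ => (p.2 - ⟪w, p.1⟫) ^ 2 -
      2 * ((p.2 - ⟪w, p.1⟫) * ⟪p.1, u⟫)) D := hsq.sub hcross
  simp_rw [risk, inner_secondMoment h.covariate, hexpand]
  rw [integral_add hdiff hquad, integral_sub hsq hcross, integral_const_mul]
  ring

lemma FiniteSecondMoments.integral_residual_mul_eq_zero (h : FiniteSecondMoments D)
    (hmin : ∀ w, risk D wStar ≤ risk D w) (u : E) :
    ∫ p, (p.2 - ⟪wStar, p.1⟫) * ⟪p.1, u⟫ ∂D = 0 := by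
  set a := ∫ p, (p.2 - ⟪wStar, p.1⟫) * ⟪p.1, u⟫ ∂D with ha
  set b := ⟪u, secondMoment D u⟫ with hb
  have hb0 : 0 ≤ b := (secondMoment_isPositive h.covariate).inner_nonneg_right u
  have hvar : ∀ s : ℝ, 0 ≤ s ^ 2 * b / 2 - s * a := fun s => by
    have hs := h.risk_add_sub_risk wStar (s • u)
    simp_rw [map_smul, inner_smul_left, inner_smul_right, mul_left_comm _ s] at hs
    rw [integral_const_mul, ← ha, ← hb] at hs
    simp only [conj_trivial] at hs
    linarith [hmin (wStar + s • u)]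
  by_contra hne
  have hs := hvar (a / (b + 1))
  have hval : (a / (b + 1)) ^ 2 * b / 2 - a / (b + 1) * a =
      -(a ^ 2 * (b + 2) / (2 * (b + 1) ^ 2)) := by field_simp; ring
  have hpos : 0 < a ^ 2 * (b + 2) / (2 * (b + 1) ^ 2) := by positivity
  linarith

lemma excessRisk_eq (h : FiniteSecondMoments D) (hmin : ∀ w, risk D wStar ≤ risk D w) (w : E) :
    excessRisk D wStar w = (1 / 2) * sqNorm (secondMoment D) (w - wStar) := by
  have := h.risk_add_sub_risk wStar (w - wStar)
  rwa [h.integral_residual_mul_eq_zero hmin, add_sub_cancel, sub_zero] at this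

end Risk

section OneStep

variable {E : Type*} [NormedAddCommGroup E] [InnerProductSpace ℝ E]

/-- The new deviation from `wStar` after an SGD step of size `r` on the sample `p`, starting at
deviation `e`. -/
def devStep (wStar : E) (r : ℝ) (e : E) (p : E × ℝ) : E :=
  e - (r * (⟪p.1, e⟫ - (p.2 - ⟪wStar, p.1⟫))) • p.1

lemma inner_devStep [CompleteSpace E] {A : E →L[ℝ] E} (hA : A.IsPositive) (wStar : E) (r : ℝ)
    (e : E) (p : E × ℝ) :
    ⟪devStep wStar r e p, A (devStep wStar r e p)⟫ =
      ⟪e, A e⟫ - 2 * r * (⟪p.1, e⟫ * ⟪p.1, A e⟫) +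
        2 * r * ((p.2 - ⟪wStar, p.1⟫) * ⟪p.1, A e⟫) +
        r ^ 2 * ((⟪p.1, e⟫ - (p.2 - ⟪wStar, p.1⟫)) ^ 2 * ⟪p.1, A p.1⟫) := by
  have hsymm : ⟪e, A p.1⟫ = ⟪p.1, A e⟫ := by
    rw [← hA.inner_left_eq_inner_right, real_inner_comm]
  simp only [devStep, map_sub, map_smul, inner_sub_left, inner_sub_right, inner_smul_left,
    inner_smul_right, hsymm, conj_trivial]
  ring

lemma inner_outer_comp_outer (A : E →L[ℝ] E) (x e : E) :
    ⟪e, (outer x ∘L A ∘L outer x) e⟫ = ⟪x, e⟫ ^ 2 * ⟪x, A x⟫ := by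
  simp only [ContinuousLinearMap.comp_apply, inner_outer]
  simp only [outer_apply, map_smul, inner_smul_right]
  ring

variable [MeasurableSpace E] {D : Measure (E × ℝ)} {wStar : E} {A : E →L[ℝ] E}

lemma WellSpecified.integral_residual {σ : ℝ} (hw : WellSpecified D wStar σ) :
    ∫ p, (p.2 - ⟪wStar, p.1⟫) ∂D = 0 := by
  rw [hw.gaussian.integral_eq, integral_id_gaussianReal]

lemma WellSpecified.integral_residual_sq {σ : ℝ} (hw : WellSpecified D wStar σ) :
    ∫ p, (p.2 - ⟪wStar, p.1⟫) ^ 2 ∂D = σ ^ 2 := by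
  have hmean : ∫ x, x ∂(gaussianReal 0 (σ ^ 2).toNNReal) = 0 := integral_id_gaussianReal
  have hvar := variance_fun_id_gaussianReal (μ := 0) (v := (σ ^ 2).toNNReal)
  rw [variance_of_integral_eq_zero (by fun_prop) hmean, Real.coe_toNNReal _ (sq_nonneg σ)] at hvar
  rw [← hvar, ← hw.gaussian.map_eq,
    integral_map hw.gaussian.aemeasurable (Continuous.aestronglyMeasurable (by fun_prop))]

variable [BorelSpace E]

lemma WellSpecified.integral_residual_mul {σ : ℝ} (hw : WellSpecified D wStar σ) {f : E → ℝ}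
    (hf : Continuous f) : ∫ p, (p.2 - ⟪wStar, p.1⟫) * f p.1 ∂D = 0 := by
  have hind : IndepFun (fun p : E × ℝ => p.2 - ⟪wStar, p.1⟫) (fun p : E × ℝ => f p.1) D :=
    hw.indep.symm.comp measurable_id hf.measurable
  rw [hind.integral_fun_mul_eq_mul_integral (Continuous.aestronglyMeasurable (by fun_prop))
    (Continuous.aestronglyMeasurable (by fun_prop)), hw.integral_residual, zero_mul]

lemma WellSpecified.integral_residual_sq_mul {σ : ℝ} (hw : WellSpecified D wStar σ) {f : E → ℝ}
    (hf : Continuous f) :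
    ∫ p, (p.2 - ⟪wStar, p.1⟫) ^ 2 * f p.1 ∂D = σ ^ 2 * ∫ p, f p.1 ∂D := by
  have hind : IndepFun (fun p : E × ℝ => (p.2 - ⟪wStar, p.1⟫) ^ 2) (fun p : E × ℝ => f p.1) D :=
    hw.indep.symm.comp (φ := fun s => s ^ 2) (by fun_prop) hf.measurable
  rw [← hw.integral_residual_sq]
  exact hind.integral_fun_mul_eq_mul_integral (Continuous.aestronglyMeasurable (by fun_prop))
    (Continuous.aestronglyMeasurable (by fun_prop))

variable [SecondCountableTopology E]

lemma integrable_outer_comp (h : Integrable (fun p : E × ℝ => ‖p.1‖ ^ 4) D) (A : E →L[ℝ] E) :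
    Integrable (fun p : E × ℝ => outer p.1 ∘L A ∘L outer p.1) D := by
  have hc : Continuous fun p : E × ℝ => outer p.1 := continuous_outer.comp continuous_fst
  refine (h.const_mul ‖A‖).mono'
    (hc.clm_comp (continuous_const.clm_comp hc)).aestronglyMeasurable (.of_forall fun p => ?_)
  have h1 := ContinuousLinearMap.opNorm_comp_le (outer p.1) (A ∘L outer p.1)
  have h2 := ContinuousLinearMap.opNorm_comp_le A (outer p.1)
  rw [norm_outer] at h1 h2
  nlinarith [sq_nonneg ‖p.1‖]

lemma integrable_inner_sq_mul (h : Integrable (fun p : E × ℝ => ‖p.1‖ ^ 4) D) (A : E →L[ℝ] E)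
    (e : E) : Integrable (fun p : E × ℝ => ⟪p.1, e⟫ ^ 2 * ⟪p.1, A p.1⟫) D := by
  simpa only [inner_outer_comp_outer] using
    ((integrable_outer_comp h A).apply_continuousLinearMap e).const_inner (𝕜 := ℝ) e

lemma integrable_residual_sq_mul
    (h : Integrable (fun p : E × ℝ => (p.2 - ⟪wStar, p.1⟫) ^ 2 * ‖p.1‖ ^ 2) D) (A : E →L[ℝ] E) :
    Integrable (fun p : E × ℝ => (p.2 - ⟪wStar, p.1⟫) ^ 2 * ⟪p.1, A p.1⟫) D := by
  refine (h.const_mul ‖A‖).mono' (by fun_prop) (.of_forall fun p => ?_)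
  rw [norm_mul, Real.norm_of_nonneg (sq_nonneg _), Real.norm_eq_abs]
  calc _ ≤ (p.2 - ⟪wStar, p.1⟫) ^ 2 * (‖A‖ * (‖p.1‖ * ‖p.1‖)) := by
        gcongr; exact abs_inner_apply_le A p.1 p.1
    _ = _ := by ring

lemma integrable_step_sq_mul (h4 : Integrable (fun p : E × ℝ => ‖p.1‖ ^ 4) D)
    (hr : Integrable (fun p : E × ℝ => (p.2 - ⟪wStar, p.1⟫) ^ 2 * ‖p.1‖ ^ 2) D)
    (hA : A.IsPositive) (e : E) :
    Integrable (fun p : E × ℝ => (⟪p.1, e⟫ - (p.2 - ⟪wStar, p.1⟫)) ^ 2 * ⟪p.1, A p.1⟫) D := by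
  refine (((integrable_inner_sq_mul h4 A e).const_mul 2).add
    ((integrable_residual_sq_mul hr A).const_mul 2)).mono' (by fun_prop) (.of_forall fun p => ?_)
  have := hA.inner_nonneg_right p.1
  rw [Real.norm_of_nonneg (by positivity), Pi.add_apply]
  nlinarith [mul_nonneg (sq_nonneg (⟪p.1, e⟫ + (p.2 - ⟪wStar, p.1⟫))) this]

lemma integrable_prod_mul_inner_sq {D' : Measure (E × ℝ)} [SFinite D'] {f : E × ℝ → ℝ}
    (hf : Continuous f) (hfi : Integrable (fun p => f p * ‖p.1‖ ^ 2) D)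
    (h' : Integrable (fun p : E × ℝ => ‖p.1‖ ^ 2) D') :
    Integrable (fun w : (E × ℝ) × (E × ℝ) => f w.1 * ⟪w.1.1, w.2.1⟫ ^ 2) (D.prod D') := by
  refine (hfi.mul_prod h').mono (Continuous.aestronglyMeasurable (by fun_prop))
    (.of_forall fun w => ?_)
  have hcs := pow_le_pow_left₀ (abs_nonneg _) (abs_real_inner_le_norm w.1.1 w.2.1) 2
  rw [sq_abs, mul_pow] at hcs
  simp only [norm_mul, norm_pow, norm_norm, mul_assoc]
  gcongr
  simpa using hcs

variable [CompleteSpace E]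

lemma inner_fourthMoment (h : Integrable (fun p : E × ℝ => ‖p.1‖ ^ 4) D) (A : E →L[ℝ] E) (e : E) :
    ⟪e, fourthMoment D A e⟫ = ∫ p, ⟪p.1, e⟫ ^ 2 * ⟪p.1, A p.1⟫ ∂D := by
  rw [fourthMoment, integral_inner_apply (integrable_outer_comp h A)]
  simp_rw [inner_outer_comp_outer]

lemma FourthMomentUpper.inner_fourthMoment_le {α : ℝ} (h4 : FourthMomentUpper D α)
    (h2 : FiniteSecondMoments D) (hA : A.IsPositive) (e : E) :
    ⟪e, fourthMoment D A e⟫ ≤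
      α * (∫ p, ⟪p.1, A p.1⟫ ∂D) * sqNorm (secondMoment D) e := by
  have := inner_apply_le_of_le (h4.bound A hA) e
  rwa [trace_secondMoment_comp h2.covariate, smul_apply, inner_smul_right] at this

lemma FourthMomentLower.le_inner_fourthMoment {β : ℝ} (h4 : FourthMomentLower D β)
    (h2 : FiniteSecondMoments D) (hA : A.IsPositive) (e : E) :
    ⟪e, secondMoment D (A (secondMoment D e))⟫ +
        β * (∫ p, ⟪p.1, A p.1⟫ ∂D) * sqNorm (secondMoment D) e ≤
      ⟪e, fourthMoment D A e⟫ := by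
  have := inner_apply_le_of_le (h4.bound A hA) e
  rw [sub_apply, inner_sub_right, trace_secondMoment_comp h2.covariate, smul_apply,
    inner_smul_right] at this
  simp only [ContinuousLinearMap.comp_apply] at this
  unfold sqNorm
  linarith

/-- The variance inequality for `⟪x, u⟫ ^ 2` against the fourth moment condition at `A = u uᵀ`. -/
lemma FourthMomentUpper.one_le [IsProbabilityMeasure D] {α : ℝ} (h4 : FourthMomentUpper D α)
    (h2 : FiniteSecondMoments D) {u : E} (hu : 0 < ⟪u, secondMoment D u⟫) : 1 ≤ α := by
  set s := ⟪u, secondMoment D u⟫ with hs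
  have hs' : s = ∫ p, ⟪p.1, u⟫ ^ 2 ∂D := by
    rw [hs, inner_secondMoment h2.covariate]; simp_rw [sq]
  have houter : ∀ x : E, ⟪x, outer u x⟫ = ⟪x, u⟫ ^ 2 := fun x => by
    rw [inner_outer, real_inner_comm x u, sq]
  have hupper := h4.inner_fourthMoment_le h2 (InnerProductSpace.isPositive_rankOne_self u) u
  rw [inner_fourthMoment h4.integrable] at hupper
  have i4 := integrable_inner_sq_mul h4.integrable (outer u) u
  change ∫ p, ⟪p.1, u⟫ ^ 2 * ⟪p.1, outer u p.1⟫ ∂D ≤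
    α * (∫ p, ⟪p.1, outer u p.1⟫ ∂D) * s at hupper
  simp_rw [houter] at hupper i4
  rw [← hs'] at hupper
  have i2 : Integrable (fun p : E × ℝ => ⟪p.1, u⟫ ^ 2) D := by
    simpa only [sq] using integrable_inner_mul_inner h2.covariate u u
  have hlower : s ^ 2 ≤ ∫ p, ⟪p.1, u⟫ ^ 2 * ⟪p.1, u⟫ ^ 2 ∂D :=
    calc s ^ 2 = ∫ p, (2 * s * ⟪p.1, u⟫ ^ 2 - s ^ 2) ∂D := by
          rw [integral_sub (i2.const_mul _) (integrable_const _), integral_const_mul, ← hs']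
          simp only [integral_const, probReal_univ, one_smul]
          ring
      _ ≤ ∫ p, ⟪p.1, u⟫ ^ 2 * ⟪p.1, u⟫ ^ 2 ∂D :=
          integral_mono ((i2.const_mul _).sub (integrable_const _)) i4 fun p => by
            nlinarith [sq_nonneg (⟪p.1, u⟫ ^ 2 - s)]
  by_contra hα
  nlinarith [mul_pos hu hu]

lemma NoiseBound.integral_inner_sq_le {σ : ℝ} (hn : NoiseBound D wStar σ) (u : E) :
    ∫ p, (p.2 - ⟪wStar, p.1⟫) ^ 2 * ⟪p.1, u⟫ ^ 2 ∂D ≤ σ ^ 2 * ⟪u, secondMoment D u⟫ := by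
  have hbound := inner_apply_le_of_le hn.bound u
  have hi : Integrable (fun p : E × ℝ => (p.2 - ⟪wStar, p.1⟫) ^ 2 • outer p.1) D :=
    hn.integrable.mono
      (Continuous.aestronglyMeasurable (by
        have hc : Continuous fun p : E × ℝ => outer p.1 := continuous_outer.comp continuous_fst
        fun_prop))
      (.of_forall fun p => by simp [norm_smul, norm_outer])
  rw [integral_inner_apply hi, smul_apply, inner_smul_right] at hbound
  simpa only [smul_apply, inner_smul_right, inner_outer, ← sq] using hbound

/-- Fubini reduces the quadratic form of a second moment to the rank one case `A = z zᵀ`. -/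
lemma NoiseBound.integral_inner_apply_le [SFinite D] {σ : ℝ} (hn : NoiseBound D wStar σ)
    (h2 : Integrable (fun p : E × ℝ => ‖p.1‖ ^ 2) D) (hA : IsSecondMoment A) :
    ∫ p, (p.2 - ⟪wStar, p.1⟫) ^ 2 * ⟪p.1, A p.1⟫ ∂D ≤ σ ^ 2 * ∫ p, ⟪p.1, A p.1⟫ ∂D := by
  obtain ⟨D', _, h', rfl⟩ := hA
  have hform : ∀ x : E, ⟪x, secondMoment D' x⟫ = ∫ z, ⟪x, z.1⟫ ^ 2 ∂D' := fun x => by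
    simp_rw [inner_secondMoment h', real_inner_comm x, sq]
  have hres := integrable_prod_mul_inner_sq (f := fun p : E × ℝ => (p.2 - ⟪wStar, p.1⟫) ^ 2)
    (by fun_prop) hn.integrable h'
  have hcov := integrable_prod_mul_inner_sq (f := fun _ : E × ℝ => σ ^ 2)
    (by fun_prop) (h2.const_mul _) h'
  simp_rw [hform, ← integral_const_mul]
  rw [integral_integral_swap hres]
  conv_rhs => rw [integral_integral_swap hcov]
  refine integral_mono hres.integral_prod_right hcov.integral_prod_right fun z => ?_
  simp only [integral_const_mul]
  simpa only [inner_secondMoment h2, ← sq] using hn.integral_inner_sq_le z.1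

section Expectation

variable (h4 : Integrable (fun p : E × ℝ => ‖p.1‖ ^ 4) D)
  (hr : Integrable (fun p : E × ℝ => (p.2 - ⟪wStar, p.1⟫) ^ 2 * ‖p.1‖ ^ 2) D)
include h4 hr

lemma integral_step_sq_mul_le (hA : A.IsPositive) (e : E) :
    ∫ p, (⟪p.1, e⟫ - (p.2 - ⟪wStar, p.1⟫)) ^ 2 * ⟪p.1, A p.1⟫ ∂D ≤
      2 * (⟪e, fourthMoment D A e⟫ + ∫ p, (p.2 - ⟪wStar, p.1⟫) ^ 2 * ⟪p.1, A p.1⟫ ∂D) := by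
  have i1 := integrable_inner_sq_mul h4 A e
  have i2 := integrable_residual_sq_mul hr A
  rw [inner_fourthMoment h4, ← integral_add i1 i2, ← integral_const_mul]
  refine integral_mono (integrable_step_sq_mul h4 hr hA e) ((i1.add i2).const_mul 2) fun p => ?_
  simp only
  nlinarith [mul_nonneg (sq_nonneg (⟪p.1, e⟫ + (p.2 - ⟪wStar, p.1⟫)))
    (hA.inner_nonneg_right p.1)]

lemma WellSpecified.integral_step_sq_mul {σ : ℝ} (hw : WellSpecified D wStar σ)
    (hA : A.IsPositive) (e : E) :
    ∫ p, (⟪p.1, e⟫ - (p.2 - ⟪wStar, p.1⟫)) ^ 2 * ⟪p.1, A p.1⟫ ∂D =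
      ⟪e, fourthMoment D A e⟫ + σ ^ 2 * ∫ p, ⟪p.1, A p.1⟫ ∂D := by
  have i1 := integrable_inner_sq_mul h4 A e
  have i2 := integrable_residual_sq_mul hr A
  have i3 : Integrable (fun p : E × ℝ =>
      (p.2 - ⟪wStar, p.1⟫) * (⟪p.1, e⟫ * ⟪p.1, A p.1⟫)) D := by
    refine (((i1.add i2).sub (integrable_step_sq_mul h4 hr hA e)).const_mul (1 / 2)).congr
      (.of_forall fun p => ?_)
    simp only [Pi.add_apply, Pi.sub_apply]; ring
  have hcross : ∫ p, (p.2 - ⟪wStar, p.1⟫) * (⟪p.1, e⟫ * ⟪p.1, A p.1⟫) ∂D = 0 :=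
    hw.integral_residual_mul (f := fun x => ⟪x, e⟫ * ⟪x, A x⟫) (by fun_prop)
  have hexpand : ∀ p : E × ℝ, (⟪p.1, e⟫ - (p.2 - ⟪wStar, p.1⟫)) ^ 2 * ⟪p.1, A p.1⟫ =
      ⟪p.1, e⟫ ^ 2 * ⟪p.1, A p.1⟫ + (p.2 - ⟪wStar, p.1⟫) ^ 2 * ⟪p.1, A p.1⟫ -
        2 * ((p.2 - ⟪wStar, p.1⟫) * (⟪p.1, e⟫ * ⟪p.1, A p.1⟫)) := fun p => by ring
  have i12 : Integrable (fun p : E × ℝ => ⟪p.1, e⟫ ^ 2 * ⟪p.1, A p.1⟫ +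
    (p.2 - ⟪wStar, p.1⟫) ^ 2 * ⟪p.1, A p.1⟫) D := i1.add i2
  simp_rw [hexpand]
  rw [integral_sub i12 (i3.const_mul 2), integral_add i1 i2, integral_const_mul, hcross,
    inner_fourthMoment h4, hw.integral_residual_sq_mul (f := fun x => ⟪x, A x⟫) (by fun_prop)]
  ring

variable [IsProbabilityMeasure D] (h2 : FiniteSecondMoments D)
include h2

lemma integrable_inner_devStep (hA : A.IsPositive) (r : ℝ) (e : E) :
    Integrable (fun p => ⟪devStep wStar r e p, A (devStep wStar r e p)⟫) D := by
  simp_rw [inner_devStep hA]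
  exact (((integrable_const _).sub
    ((integrable_inner_mul_inner h2.covariate e (A e)).const_mul _)).add
    ((h2.integrable_residual_mul wStar (A e)).const_mul _)).add
    ((integrable_step_sq_mul h4 hr hA e).const_mul _)

lemma integral_inner_devStep (hmin : ∀ w, risk D wStar ≤ risk D w) (hA : A.IsPositive) (r : ℝ)
    (e : E) :
    ∫ p, ⟪devStep wStar r e p, A (devStep wStar r e p)⟫ ∂D =
      ⟪e, A e⟫ - 2 * r * ⟪e, secondMoment D (A e)⟫ +
        r ^ 2 * ∫ p, (⟪p.1, e⟫ - (p.2 - ⟪wStar, p.1⟫)) ^ 2 * ⟪p.1, A p.1⟫ ∂D := by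
  have i1 : Integrable (fun _ : E × ℝ => ⟪e, A e⟫) D := integrable_const _
  have i2 := (integrable_inner_mul_inner h2.covariate e (A e)).const_mul (2 * r)
  have i3 := (h2.integrable_residual_mul wStar (A e)).const_mul (2 * r)
  have i4 := (integrable_step_sq_mul h4 hr hA e).const_mul (r ^ 2)
  have i12 : Integrable (fun p : E × ℝ => ⟪e, A e⟫ - 2 * r * (⟪p.1, e⟫ * ⟪p.1, A e⟫)) D :=
    i1.sub i2
  have i123 : Integrable (fun p : E × ℝ => ⟪e, A e⟫ - 2 * r * (⟪p.1, e⟫ * ⟪p.1, A e⟫) +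
    2 * r * ((p.2 - ⟪wStar, p.1⟫) * ⟪p.1, A e⟫)) D := i12.add i3
  simp_rw [inner_devStep hA]
  rw [integral_add i123 i4, integral_add i12 i3, integral_sub i1 i2, integral_const_mul,
    integral_const_mul, integral_const_mul, h2.integral_residual_mul_eq_zero hmin,
    inner_secondMoment h2.covariate]
  simp

end Expectation

variable [IsProbabilityMeasure D]

lemma integral_inner_devStep_le {α σ : ℝ} (h2 : FiniteSecondMoments D)
    (hmin : ∀ w, risk D wStar ≤ risk D w) (h4 : FourthMomentUpper D α)
    (hn : NoiseBound D wStar σ) (hA : IsSecondMoment A) (r : ℝ) (e : E) :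
    ∫ p, ⟪devStep wStar r e p, A (devStep wStar r e p)⟫ ∂D ≤
      ⟪e, congruence (ContinuousLinearMap.id ℝ E - r • secondMoment D) A e⟫ +
        2 * r ^ 2 * (∫ p, ⟪p.1, A p.1⟫ ∂D) * (α * sqNorm (secondMoment D) e + σ ^ 2) := by
  have hG := secondMoment_isPositive h2.covariate
  have hmoment := h4.inner_fourthMoment_le h2 hA.isPositive e
  have hnoise := hn.integral_inner_apply_le h2.covariate hA
  have hstep := integral_step_sq_mul_le h4.integrable hn.integrable hA.isPositive e
  have hGAG : 0 ≤ ⟪e, secondMoment D (A (secondMoment D e))⟫ := by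
    rw [← hG.inner_left_eq_inner_right]
    exact hA.isPositive.inner_nonneg_right _
  rw [integral_inner_devStep h4.integrable hn.integrable h2 hmin hA.isPositive,
    inner_congruence_id_sub_smul hA.isPositive hG]
  nlinarith [mul_nonneg (sq_nonneg r) hGAG, mul_le_mul_of_nonneg_left
    (hstep.trans (mul_le_mul_of_nonneg_left (add_le_add hmoment hnoise) two_pos.le)) (sq_nonneg r)]

lemma le_integral_inner_devStep {β σ : ℝ} (h2 : FiniteSecondMoments D)
    (hmin : ∀ w, risk D wStar ≤ risk D w) (h4 : FourthMomentLower D β)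
    (hr : Integrable (fun p : E × ℝ => (p.2 - ⟪wStar, p.1⟫) ^ 2 * ‖p.1‖ ^ 2) D)
    (hw : WellSpecified D wStar σ) (hA : A.IsPositive) (r : ℝ) (e : E) :
    ⟪e, congruence (ContinuousLinearMap.id ℝ E - r • secondMoment D) A e⟫ +
        r ^ 2 * (∫ p, ⟪p.1, A p.1⟫ ∂D) * (β * sqNorm (secondMoment D) e + σ ^ 2) ≤
      ∫ p, ⟪devStep wStar r e p, A (devStep wStar r e p)⟫ ∂D := by
  rw [integral_inner_devStep h4.integrable hr h2 hmin hA,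
    inner_congruence_id_sub_smul hA (secondMoment_isPositive h2.covariate),
    hw.integral_step_sq_mul h4.integrable hr hA]
  nlinarith [mul_le_mul_of_nonneg_left (h4.le_inner_fourthMoment h2 hA e) (sq_nonneg r)]

end OneStep

section Iterates

variable {E : Type*} [NormedAddCommGroup E] [InnerProductSpace ℝ E]

lemma sgd_sub_succ (η : ℕ → ℝ) (w₀ wStar : E) (z : ℕ → E × ℝ) (t : ℕ) :
    sgd η w₀ z (t + 1) - wStar = devStep wStar (η t) (sgd η w₀ z t - wStar) (z t) := by
  have h : ⟪(z t).1, sgd η w₀ z t⟫ =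
      ⟪(z t).1, sgd η w₀ z t - wStar⟫ + ⟪wStar, (z t).1⟫ := by
    rw [inner_sub_right, real_inner_comm wStar]; ring
  rw [sgd, devStep, outer_apply, h]
  module

lemma sgd_congr (η : ℕ → ℝ) (w₀ : E) {z z' : ℕ → E × ℝ} (t : ℕ) (h : ∀ s < t, z s = z' s) :
    sgd η w₀ z t = sgd η w₀ z' t := by
  induction t with
  | zero => rfl
  | succ t ih => rw [sgd, sgd, ih fun s hs => h s (hs.trans t.lt_succ_self), h t t.lt_succ_self]

lemma continuous_devStep (wStar : E) (r : ℝ) :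
    Continuous fun q : E × (E × ℝ) => devStep wStar r q.1 q.2 := by
  unfold devStep; fun_prop

lemma continuous_sqNorm (A : E →L[ℝ] E) : Continuous (sqNorm A) := by
  unfold sqNorm; fun_prop

lemma sqNorm_nonneg [CompleteSpace E] {A : E →L[ℝ] E} (hA : A.IsPositive) (u : E) :
    0 ≤ sqNorm A u :=
  hA.inner_nonneg_right u

variable [MeasurableSpace E] [BorelSpace E] [SecondCountableTopology E]

lemma measurable_sgd (η : ℕ → ℝ) (w₀ : E) {X : Type*} [MeasurableSpace X] {z : X → ℕ → E × ℝ}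
    (hz : ∀ t, Measurable fun x => z x t) (t : ℕ) : Measurable fun x => sgd η w₀ (z x) t := by
  induction t with
  | zero => exact measurable_const
  | succ t ih =>
    have h : (fun x => sgd η w₀ (z x) (t + 1)) =
        (fun q : E × (E × ℝ) => devStep 0 (η t) q.1 q.2) ∘
          fun x => (sgd η w₀ (z x) t, z x t) := by
      funext x; simpa using sgd_sub_succ η w₀ 0 (z x) t
    rw [h]
    exact (continuous_devStep 0 (η t)).measurable.comp (ih.prodMk (hz t))

lemma exists_measurable_sgd_eq {M : ℕ} (η : ℕ → ℝ) (w₀ : E) (S : Finset (Fin M)) {t : ℕ}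
    (hS : ∀ s : Fin M, (s : ℕ) < t → s ∈ S) (htM : t ≤ M) :
    ∃ g : (S → E × ℝ) → E, Measurable g ∧
      ∀ z : ℕ → E × ℝ, sgd η w₀ z t = g fun s => z s.1 := by
  classical
  refine ⟨fun y => sgd η w₀ (fun k => if h : ∃ hk : k < M, (⟨k, hk⟩ : Fin M) ∈ S then
    y ⟨⟨k, h.1⟩, h.2⟩ else 0) t, measurable_sgd η w₀ (fun k => ?_) t, fun z => ?_⟩
  · by_cases h : ∃ hk : k < M, (⟨k, hk⟩ : Fin M) ∈ S
    · simp only [h, dite_true]; exact measurable_pi_apply _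
    · simp only [h, dite_false]; exact measurable_const
  · refine sgd_congr η w₀ t fun s hs => ?_
    have h : ∃ hk : s < M, (⟨s, hk⟩ : Fin M) ∈ S := ⟨hs.trans_le htM, hS _ hs⟩
    simp only [h, dite_true]

end Iterates

section Energy

lemma lintegral_prodMk_of_indepFun {X Y Ω : Type*} [MeasurableSpace X] [MeasurableSpace Y]
    [MeasurableSpace Ω] {P : Measure Ω} {D : Measure Y} [IsFiniteMeasure P] [SFinite D]
    {W : Ω → X} {Z : Ω → Y} (hW : AEMeasurable W P) (hZ : HasLaw Z D P) (h : IndepFun W Z P)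
    {F : X × Y → ℝ≥0∞} (hF : Measurable F) :
    ∫⁻ ω, F (W ω, Z ω) ∂P = ∫⁻ ω, ∫⁻ p, F (W ω, p) ∂D ∂P := by
  have hprod := (indepFun_iff_map_prod_eq_prod_map_map hW hZ.aemeasurable).1 h
  rw [hZ.map_eq] at hprod
  calc ∫⁻ ω, F (W ω, Z ω) ∂P
      = ∫⁻ q, F q ∂(P.map fun ω => (W ω, Z ω)) :=
        (lintegral_map' hF.aemeasurable (hW.prodMk hZ.aemeasurable)).symm
    _ = ∫⁻ w, ∫⁻ p, F (w, p) ∂D ∂(P.map W) := by rw [hprod, lintegral_prod _ hF.aemeasurable]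
    _ = ∫⁻ ω, ∫⁻ p, F (W ω, p) ∂D ∂P := lintegral_map' hF.lintegral_prod_right'.aemeasurable hW

lemma lintegral_ofReal_add_mul {Ω : Type*} [MeasurableSpace Ω] {P : Measure Ω}
    [IsProbabilityMeasure P] {f g : Ω → ℝ} {a b c : ℝ} (hf : ∀ ω, 0 ≤ f ω) (hg : ∀ ω, 0 ≤ g ω)
    (hfm : AEMeasurable f P) (ha : 0 ≤ a) (hb : 0 ≤ b) (hc : 0 ≤ c) :
    ∫⁻ ω, ENNReal.ofReal (f ω + a * (b * g ω + c)) ∂P =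
      ∫⁻ ω, ENNReal.ofReal (f ω) ∂P + ENNReal.ofReal a *
        (ENNReal.ofReal b * ∫⁻ ω, ENNReal.ofReal (g ω) ∂P + ENNReal.ofReal c) := by
  have h : ∀ ω, ENNReal.ofReal (f ω + a * (b * g ω + c)) = ENNReal.ofReal (f ω) +
      ENNReal.ofReal a * (ENNReal.ofReal b * ENNReal.ofReal (g ω) + ENNReal.ofReal c) := fun ω => by
    have := hg ω
    rw [ENNReal.ofReal_add (hf ω) (by positivity), ENNReal.ofReal_mul ha,
      ENNReal.ofReal_add (by positivity) hc, ENNReal.ofReal_mul hb]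
  simp_rw [h]
  rw [lintegral_add_left' hfm.ennreal_ofReal, lintegral_const_mul' _ _ ENNReal.ofReal_ne_top,
    lintegral_add_right' _ aemeasurable_const, lintegral_const_mul' _ _ ENNReal.ofReal_ne_top]
  simp

variable {E : Type*} [NormedAddCommGroup E] [InnerProductSpace ℝ E] {Ω : Type*}
  [MeasurableSpace Ω] {P : Measure Ω} {Z : ℕ → Ω → E × ℝ} {M : ℕ} {wStar : E}

/-- The expected quadratic form `𝔼⟪w_t - wStar, A (w_t - wStar)⟫` of the deviation of the SGD
iterate, with values in `[0, ∞]` so that no integrability is needed to speak of it. -/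
def energy (P : Measure Ω) (Z : ℕ → Ω → E × ℝ) (η : ℕ → ℝ) (w₀ wStar : E) (t : ℕ)
    (A : E →L[ℝ] E) : ℝ≥0∞ :=
  ∫⁻ ω, ENNReal.ofReal (sqNorm A (sgd η w₀ (fun k => Z k ω) t - wStar)) ∂P

lemma energy_zero [IsProbabilityMeasure P] (η : ℕ → ℝ) (w₀ wStar : E) (A : E →L[ℝ] E) :
    energy P Z η w₀ wStar 0 A = ENNReal.ofReal (sqNorm A (w₀ - wStar)) := by
  simp [energy, sgd]

variable [MeasurableSpace E] [BorelSpace E] [SecondCountableTopology E] {D : Measure (E × ℝ)}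
  (hZ : ∀ t < M, HasLaw (Z t) D P)
include hZ

lemma aemeasurable_sgd (η : ℕ → ℝ) (w₀ : E) {t : ℕ} (ht : t ≤ M) :
    AEMeasurable (fun ω => sgd η w₀ (fun k => Z k ω) t) P := by
  obtain ⟨g, hg, h⟩ := exists_measurable_sgd_eq (M := M) η w₀ Finset.univ
    (fun _ _ => Finset.mem_univ _) ht
  simp_rw [h]
  exact hg.comp_aemeasurable (aemeasurable_pi_lambda _ fun s => (hZ _ s.1.2).aemeasurable)

lemma aemeasurable_sqNorm_sgd (η : ℕ → ℝ) (w₀ : E) {t : ℕ} (ht : t ≤ M) (A : E →L[ℝ] E) :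
    AEMeasurable (fun ω => sqNorm A (sgd η w₀ (fun k => Z k ω) t - wStar)) P :=
  ((continuous_sqNorm A).comp (continuous_id.sub continuous_const)).measurable.comp_aemeasurable
    (aemeasurable_sgd hZ η w₀ ht)

variable (hi : iIndepFun (fun t : Fin M => Z t) P)
include hi

lemma indepFun_sgd (η : ℕ → ℝ) (w₀ : E) {t : ℕ} (ht : t < M) :
    IndepFun (fun ω => sgd η w₀ (fun k => Z k ω) t) (Z t) P := by
  classical
  set S : Finset (Fin M) := Finset.univ.filter fun s => (s : ℕ) < t
  obtain ⟨g, hg, h⟩ := exists_measurable_sgd_eq (M := M) η w₀ S (t := t)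
    (fun s hs => by simpa [S] using hs) ht.le
  have hdisj : Disjoint S {⟨t, ht⟩} := by simp [S]
  have hind := (hi.indepFun_finset₀ S {⟨t, ht⟩} hdisj fun s => (hZ _ s.2).aemeasurable).comp hg
    (measurable_pi_apply (⟨⟨t, ht⟩, Finset.mem_singleton_self _⟩ :
      ({⟨t, ht⟩} : Finset (Fin M))))
  simp_rw [h]
  exact hind

variable [CompleteSpace E] [IsProbabilityMeasure D] [IsProbabilityMeasure P]
  (h2 : FiniteSecondMoments D)
include h2

lemma energy_succ (h4 : Integrable (fun p : E × ℝ => ‖p.1‖ ^ 4) D)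
    (hr : Integrable (fun p : E × ℝ => (p.2 - ⟪wStar, p.1⟫) ^ 2 * ‖p.1‖ ^ 2) D)
    {A : E →L[ℝ] E} (hA : A.IsPositive) (η : ℕ → ℝ) (w₀ : E) {t : ℕ} (ht : t < M) :
    energy P Z η w₀ wStar (t + 1) A = ∫⁻ ω, ENNReal.ofReal (∫ p,
      sqNorm A (devStep wStar (η t) (sgd η w₀ (fun k => Z k ω) t - wStar) p) ∂D) ∂P := by
  have hF : Measurable fun q : E × (E × ℝ) =>
      ENNReal.ofReal (sqNorm A (devStep wStar (η t) (q.1 - wStar) q.2)) :=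
    ENNReal.measurable_ofReal.comp <| Continuous.measurable <|
      (continuous_sqNorm A).comp ((continuous_devStep wStar (η t)).comp
        ((continuous_fst.sub continuous_const).prodMk continuous_snd))
  simp only [energy, sgd_sub_succ]
  rw [lintegral_prodMk_of_indepFun (aemeasurable_sgd hZ η w₀ ht.le) (hZ t ht)
    (indepFun_sgd hZ hi η w₀ ht) hF]
  refine lintegral_congr fun ω => ?_
  rw [ofReal_integral_eq_lintegral_ofReal]
  · exact integrable_inner_devStep h4 hr h2 hA _ _
  · exact .of_forall fun p => sqNorm_nonneg hA _

variable (hmin : ∀ w, risk D wStar ≤ risk D w)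
include hmin

lemma energy_succ_le {α σ : ℝ} (h4 : FourthMomentUpper D α) (hα : 0 ≤ α)
    (hn : NoiseBound D wStar σ) {A : E →L[ℝ] E} (hA : IsSecondMoment A) (η : ℕ → ℝ) (w₀ : E)
    {t : ℕ} (ht : t < M) :
    energy P Z η w₀ wStar (t + 1) A ≤
      energy P Z η w₀ wStar t (congruence (ContinuousLinearMap.id ℝ E - η t • secondMoment D) A) +
        ENNReal.ofReal (2 * η t ^ 2 * ∫ p, ⟪p.1, A p.1⟫ ∂D) *
          (ENNReal.ofReal α * energy P Z η w₀ wStar t (secondMoment D) +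
            ENNReal.ofReal (σ ^ 2)) := by
  have hT : 0 ≤ ∫ p, ⟪p.1, A p.1⟫ ∂D := integral_nonneg fun p =>
    hA.isPositive.inner_nonneg_right p.1
  rw [energy_succ hZ hi h2 h4.integrable hn.integrable hA.isPositive η w₀ ht]
  unfold energy
  rw [← lintegral_ofReal_add_mul (fun ω => sqNorm_nonneg (hA.congruence _).isPositive _)
    (fun ω => sqNorm_nonneg (secondMoment_isPositive h2.covariate) _)
    (aemeasurable_sqNorm_sgd hZ η w₀ ht.le _)
    (by positivity) hα (sq_nonneg σ)]
  exact lintegral_mono fun ω => ENNReal.ofReal_le_ofReal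
    (integral_inner_devStep_le h2 hmin h4 hn hA _ _)

lemma le_energy_succ {β σ : ℝ} (h4 : FourthMomentLower D β) (hβ : 0 ≤ β)
    (hr : Integrable (fun p : E × ℝ => (p.2 - ⟪wStar, p.1⟫) ^ 2 * ‖p.1‖ ^ 2) D)
    (hw : WellSpecified D wStar σ) {A : E →L[ℝ] E} (hA : IsSecondMoment A) (η : ℕ → ℝ) (w₀ : E)
    {t : ℕ} (ht : t < M) :
    energy P Z η w₀ wStar t (congruence (ContinuousLinearMap.id ℝ E - η t • secondMoment D) A) +
        ENNReal.ofReal (η t ^ 2 * ∫ p, ⟪p.1, A p.1⟫ ∂D) *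
          (ENNReal.ofReal β * energy P Z η w₀ wStar t (secondMoment D) +
            ENNReal.ofReal (σ ^ 2)) ≤ energy P Z η w₀ wStar (t + 1) A := by
  have hT : 0 ≤ ∫ p, ⟪p.1, A p.1⟫ ∂D := integral_nonneg fun p =>
    hA.isPositive.inner_nonneg_right p.1
  rw [energy_succ hZ hi h2 h4.integrable hr hA.isPositive η w₀ ht]
  unfold energy
  rw [← lintegral_ofReal_add_mul (fun ω => sqNorm_nonneg (hA.congruence _).isPositive _)
    (fun ω => sqNorm_nonneg (secondMoment_isPositive h2.covariate) _)
    (aemeasurable_sqNorm_sgd hZ η w₀ ht.le _)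
    (by positivity) hβ (sq_nonneg σ)]
  exact lintegral_mono fun ω => ENNReal.ofReal_le_ofReal
    (le_integral_inner_devStep h2 hmin h4 hr hw hA.isPositive _ _)

lemma energy_ne_top {α σ : ℝ} (h4 : FourthMomentUpper D α) (hα : 0 ≤ α)
    (hn : NoiseBound D wStar σ) (η : ℕ → ℝ) (w₀ : E) {t : ℕ} (ht : t ≤ M) {A : E →L[ℝ] E}
    (hA : IsSecondMoment A) : energy P Z η w₀ wStar t A ≠ ∞ := by
  induction t generalizing A with
  | zero => rw [energy_zero]; exact ENNReal.ofReal_ne_top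
  | succ t ih =>
    refine ne_top_of_le_ne_top ?_ (energy_succ_le hZ hi h2 hmin h4 hα hn hA η w₀ ht)
    have hbias := ih (Nat.le_of_lt ht)
      (hA.congruence (ContinuousLinearMap.id ℝ E - η t • secondMoment D))
    have hnoise := ih (Nat.le_of_lt ht) (isSecondMoment_secondMoment h2.covariate)
    finiteness

end Energy

section Unrolling

variable {E : Type*} [NormedAddCommGroup E] [InnerProductSpace ℝ E] {ι : Type*}

lemma contraction_succ (η : ℕ → ℝ) (G : E →L[ℝ] E) (t : ℕ) :
    contraction η G (t + 1) = contraction η G t * (ContinuousLinearMap.id ℝ E - η t • G) := by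
  simp [contraction, List.range_succ]

lemma commute_contraction (η : ℕ → ℝ) (G : E →L[ℝ] E) (r : ℝ) (t : ℕ) :
    Commute (ContinuousLinearMap.id ℝ E - r • G) (contraction η G t) := by
  refine Commute.list_prod_right _ _ fun x hx => ?_
  obtain ⟨s, -, rfl⟩ := List.mem_map.1 hx
  change Commute (1 - r • G) (1 - η s • G)
  exact (Commute.one_left _).sub_left ((Commute.one_right _).sub_right
    (((Commute.refl G).smul_right _).smul_left _))

lemma contraction_succ_apply (η : ℕ → ℝ) (G : E →L[ℝ] E) (t : ℕ) (u : E) :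
    contraction η G (t + 1) u =
      (ContinuousLinearMap.id ℝ E - η t • G) (contraction η G t u) := by
  rw [contraction_succ, ← (commute_contraction η G (η t) t).eq]; rfl

/-- `tr(G P A P)`, where `P = ∏_{s ≤ k < t} (I - η_k G)` and `G` has eigenbasis `v` with
eigenvalues `μ`. -/
def contractedTrace (v : HilbertBasis ι ℝ E) (μ : ι → ℝ) (η : ℕ → ℝ) (s t : ℕ)
    (A : E →L[ℝ] E) : ℝ := ∑' j, μ j * decay η (μ j) s t ^ 2 * ⟪v j, A (v j)⟫

/-- The part of the expected quadratic form `A` at time `t` that is due to noise of covariance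
`q s • G` injected at the steps `s < t`, where `G` has eigenbasis `v` with eigenvalues `μ`. -/
def unrolledNoise (v : HilbertBasis ι ℝ E) (μ : ι → ℝ) (η q : ℕ → ℝ) (t : ℕ)
    (A : E →L[ℝ] E) : ℝ :=
  ∑ s ∈ Finset.range t, η s ^ 2 * q s * contractedTrace v μ η (s + 1) t A

/-- The expected quadratic form `A` at time `t` of the iteration `u ↦ (I - η_s G) u`, started from
`u` and driven by noise of covariance `q s • G`. -/
def unrolledEnergy (v : HilbertBasis ι ℝ E) (μ : ι → ℝ) (G : E →L[ℝ] E) (η q : ℕ → ℝ) (u : E)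
    (t : ℕ) (A : E →L[ℝ] E) : ℝ :=
  sqNorm A (contraction η G t u) + unrolledNoise v μ η q t A

lemma unrolledNoise_const_mul (v : HilbertBasis ι ℝ E) (μ : ι → ℝ) (η q : ℕ → ℝ) (c : ℝ) (t : ℕ)
    (A : E →L[ℝ] E) :
    unrolledNoise v μ η (fun s => c * q s) t A = c * unrolledNoise v μ η q t A := by
  rw [unrolledNoise, unrolledNoise, Finset.mul_sum]
  exact Finset.sum_congr rfl fun s _ => by ring

variable {v : HilbertBasis ι ℝ E} {μ : ι → ℝ} {G : E →L[ℝ] E}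

lemma unrolledEnergy_zero (η q : ℕ → ℝ) (u : E) (A : E →L[ℝ] E) :
    unrolledEnergy v μ G η q u 0 A = sqNorm A u := by
  simp [unrolledEnergy, unrolledNoise, contraction]

lemma inner_contraction (hG : G.IsPositive) (hv : ∀ j, G (v j) = μ j • v j) (η : ℕ → ℝ) (t : ℕ)
    (u : E) (j : ι) : ⟪v j, contraction η G t u⟫ = decay η (μ j) 0 t * ⟪v j, u⟫ := by
  induction t with
  | zero => simp [contraction, decay]
  | succ t ih =>
    rw [contraction_succ_apply, decay_succ _ _ (Nat.zero_le t), sub_apply, inner_sub_right,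
      smul_apply, inner_smul_right, ← hG.inner_left_eq_inner_right, hv, inner_smul_left,
      ContinuousLinearMap.id_apply, ih]
    simp only [conj_trivial]; ring

lemma hasSum_sqNorm (hG : G.IsPositive) (hv : ∀ j, G (v j) = μ j • v j) (u : E) :
    HasSum (fun j => μ j * ⟪v j, u⟫ ^ 2) (sqNorm G u) := by
  refine (v.hasSum_inner_mul_inner u (G u)).congr_fun fun j => ?_
  rw [← hG.inner_left_eq_inner_right, hv, inner_smul_left, real_inner_comm u]
  simp only [conj_trivial]; ring

lemma hasSum_sqNorm_contraction (hG : G.IsPositive) (hv : ∀ j, G (v j) = μ j • v j) (η : ℕ → ℝ)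
    (t : ℕ) (u : E) :
    HasSum (fun j => μ j * decay η (μ j) 0 t ^ 2 * ⟪v j, u⟫ ^ 2)
      (sqNorm G (contraction η G t u)) := by
  refine (hasSum_sqNorm hG hv (contraction η G t u)).congr_fun fun j => ?_
  rw [inner_contraction hG hv]; ring

variable [CompleteSpace E]

lemma contractedTrace_congruence (hv : ∀ j, G (v j) = μ j • v j) (η : ℕ → ℝ) {s t : ℕ}
    (hst : s ≤ t) (A : E →L[ℝ] E) :
    contractedTrace v μ η s t (congruence (ContinuousLinearMap.id ℝ E - η t • G) A) =
      contractedTrace v μ η s (t + 1) A := by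
  refine tsum_congr fun j => ?_
  have heigen : (ContinuousLinearMap.id ℝ E - η t • G) (v j) = (1 - η t * μ j) • v j := by
    rw [sub_apply, smul_apply, hv, ContinuousLinearMap.id_apply]; module
  rw [decay_succ _ _ hst, inner_congruence, heigen, map_smul, inner_smul_left, inner_smul_right]
  simp only [conj_trivial]; ring

lemma unrolledNoise_succ (hv : ∀ j, G (v j) = μ j • v j) (η q : ℕ → ℝ) (t : ℕ)
    (A : E →L[ℝ] E) :
    unrolledNoise v μ η q (t + 1) A =
      unrolledNoise v μ η q t (congruence (ContinuousLinearMap.id ℝ E - η t • G) A) +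
        η t ^ 2 * q t * ∑' j, μ j * ⟪v j, A (v j)⟫ := by
  rw [unrolledNoise, unrolledNoise, Finset.sum_range_succ]
  congr 1
  · refine Finset.sum_congr rfl fun s hs => ?_
    rw [contractedTrace_congruence hv η (Finset.mem_range.1 hs)]
  · simp [contractedTrace, decay_self]

lemma unrolledEnergy_succ (hv : ∀ j, G (v j) = μ j • v j) (η q : ℕ → ℝ) (u : E) (t : ℕ)
    (A : E →L[ℝ] E) :
    unrolledEnergy v μ G η q u (t + 1) A =
      unrolledEnergy v μ G η q u t (congruence (ContinuousLinearMap.id ℝ E - η t • G) A) +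
        η t ^ 2 * q t * ∑' j, μ j * ⟪v j, A (v j)⟫ := by
  rw [unrolledEnergy, unrolledEnergy, unrolledNoise_succ hv, ← add_assoc, sqNorm, sqNorm,
    inner_congruence, contraction_succ_apply]

end Unrolling

section Weights

variable {E : Type*} [NormedAddCommGroup E] [InnerProductSpace ℝ E] {ι : Type*}

lemma summable_mul_inner_sq [CompleteSpace E] (v : HilbertBasis ι ℝ E) (u : E) {φ : ι → ℝ} {c : ℝ}
    (h0 : ∀ j, 0 ≤ φ j) (hc : ∀ j, φ j ≤ c) : Summable fun j => φ j * ⟪v j, u⟫ ^ 2 := by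
  simp_rw [real_inner_comm u]
  exact ((hasSum_inner_sq v u).summable.mul_left c).of_nonneg_of_le
    (fun j => mul_nonneg (h0 j) (sq_nonneg _))
    fun j => mul_le_mul_of_nonneg_right (hc j) (sq_nonneg _)

lemma weightedSq_eq_ofReal [CompleteSpace E] (v : HilbertBasis ι ℝ E) (u : E) {φ : ι → ℝ} {c : ℝ}
    (h0 : ∀ j, 0 ≤ φ j) (hc : ∀ j, φ j ≤ c) :
    weightedSq v φ u = ENNReal.ofReal (∑' j, φ j * ⟪v j, u⟫ ^ 2) :=
  (ENNReal.ofReal_tsum_of_nonneg (fun j => mul_nonneg (h0 j) (sq_nonneg _))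
    (summable_mul_inner_sq v u h0 hc)).symm

lemma weightedTrace_mono (v : HilbertBasis ι ℝ E) {φ ψ : ι → ℝ} (h : ∀ j, φ j ≤ ψ j)
    {A : E →L[ℝ] E} (hA : A.IsPositive) : weightedTrace v φ A ≤ weightedTrace v ψ A :=
  ENNReal.tsum_le_tsum fun j => ENNReal.ofReal_le_ofReal
    (mul_le_mul_of_nonneg_right (h j) (hA.inner_nonneg_right _))

lemma weightedTrace_const_mul (v : HilbertBasis ι ℝ E) {c : ℝ} (hc : 0 ≤ c) (φ : ι → ℝ)
    (A : E →L[ℝ] E) :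
    weightedTrace v (fun j => c * φ j) A = ENNReal.ofReal c * weightedTrace v φ A := by
  simp_rw [weightedTrace, mul_assoc, ENNReal.ofReal_mul hc, ENNReal.tsum_mul_left]

lemma weightedTrace_add (v : HilbertBasis ι ℝ E) {φ ψ : ι → ℝ} (hφ : ∀ j, 0 ≤ φ j)
    (hψ : ∀ j, 0 ≤ ψ j) {A : E →L[ℝ] E} (hA : A.IsPositive) :
    weightedTrace v (fun j => φ j + ψ j) A = weightedTrace v φ A + weightedTrace v ψ A := by
  rw [weightedTrace, weightedTrace, weightedTrace, ← ENNReal.tsum_add]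
  refine tsum_congr fun j => ?_
  have hAj := hA.inner_nonneg_right (v j)
  rw [add_mul, ENNReal.ofReal_add (mul_nonneg (hφ j) hAj) (mul_nonneg (hψ j) hAj)]

variable {μ : ι → ℝ} {J : Set ι} {j : ι}

/-- Spectral weights of `G_J⁻¹ + c G_{Jᶜ}`, where `μ` lists the eigenvalues of `G`. For
`c = m² γ²` the trace of `H` against this operator is `effDim v μ J H m γ`. -/
def headInvTail (c : ℝ) (μ : ι → ℝ) (J : Set ι) : ι → ℝ := fun j => headInv μ J j + c * tail μ J j

lemma headInvTail_of_mem (c : ℝ) (μ : ι → ℝ) (hj : j ∈ J) : headInvTail c μ J j = (μ j)⁻¹ := by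
  simp [headInvTail, headInv, tail, hj]

lemma headInvTail_of_notMem (c : ℝ) (μ : ι → ℝ) (hj : j ∉ J) :
    headInvTail c μ J j = c * μ j := by
  simp [headInvTail, headInv, tail, hj]

lemma headConstTail_of_mem (a : ℝ) (μ : ι → ℝ) (hj : j ∈ J) : headConstTail a μ J j = a := by
  simp [headConstTail, tail, hj]

lemma headConstTail_of_notMem (a : ℝ) (μ : ι → ℝ) (hj : j ∉ J) :
    headConstTail a μ J j = μ j := by
  simp [headConstTail, tail, hj]

lemma tail_nonneg (hμ : ∀ j, 0 ≤ μ j) (J : Set ι) (j : ι) : 0 ≤ tail μ J j :=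
  Set.indicator_nonneg (fun i _ => hμ i) j

lemma tail_le {b : ℝ} (hμ : ∀ j, 0 ≤ μ j) (hb : ∀ j, μ j ≤ b) (J : Set ι) (j : ι) :
    tail μ J j ≤ b :=
  (Set.indicator_le_self' (fun i _ => hμ i) j).trans (hb j)

lemma headConstTail_nonneg {a : ℝ} (ha : 0 ≤ a) (hμ : ∀ j, 0 ≤ μ j) (J : Set ι) (j : ι) :
    0 ≤ headConstTail a μ J j :=
  add_nonneg (Set.indicator_nonneg (fun _ _ => ha) j) (tail_nonneg hμ J j)

lemma headConstTail_le {a b : ℝ} (ha : 0 ≤ a) (hμ : ∀ j, 0 ≤ μ j) (hb : ∀ j, μ j ≤ b) (J : Set ι)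
    (j : ι) : headConstTail a μ J j ≤ a + b :=
  add_le_add (Set.indicator_le_self' (fun _ _ => ha) j) (tail_le hμ hb J j)

lemma effDim_eq_weightedTrace (v : HilbertBasis ι ℝ E) (hμ : ∀ j, 0 ≤ μ j) (J : Set ι)
    {H : E →L[ℝ] E} (hH : H.IsPositive) (m γ : ℝ) :
    effDim v μ J H m γ = weightedTrace v (headInvTail (m ^ 2 * γ ^ 2) μ J) H := by
  have hc : 0 ≤ m ^ 2 * γ ^ 2 := by positivity
  rw [effDim, ← weightedTrace_const_mul v hc]
  exact (weightedTrace_add v (Set.indicator_nonneg fun i _ => inv_nonneg.2 (hμ i))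
    (fun j => mul_nonneg hc (tail_nonneg hμ J j)) hH).symm

end Weights

section Spectrum

variable {E : Type*} [NormedAddCommGroup E] [InnerProductSpace ℝ E] {ι : Type*}

/-- `v` is an eigenbasis of the positive operator `G`, with positive eigenvalues `μ` whose sum, the
trace of `G`, is `T`. -/
structure IsEigenbasis (v : HilbertBasis ι ℝ E) (μ : ι → ℝ) (G : E →L[ℝ] E) (T : ℝ) : Prop where
  isPositive : G.IsPositive
  eigen : ∀ j, G (v j) = μ j • v j
  pos : ∀ j, 0 < μ j
  hasSum : HasSum μ T

variable {v : HilbertBasis ι ℝ E} {μ : ι → ℝ} {G A : E →L[ℝ] E} {T : ℝ}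

lemma IsEigenbasis.nonneg (h : IsEigenbasis v μ G T) (j : ι) : 0 ≤ μ j := (h.pos j).le

lemma IsEigenbasis.le_trace (h : IsEigenbasis v μ G T) (j : ι) : μ j ≤ T :=
  le_hasSum h.hasSum j fun i _ => h.nonneg i

lemma IsEigenbasis.mul_le {γ b : ℝ} (h : IsEigenbasis v μ G T) (hγ : 0 ≤ γ) (hb : γ * T ≤ b)
    (j : ι) : γ * μ j ≤ b :=
  (mul_le_mul_of_nonneg_left (h.le_trace j) hγ).trans hb

lemma IsEigenbasis.inner_eq (h : IsEigenbasis v μ G T) (j : ι) : ⟪v j, G (v j)⟫ = μ j := by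
  rw [h.eigen, inner_smul_right, real_inner_self_eq_norm_sq, v.orthonormal.1, one_pow, mul_one]

lemma IsEigenbasis.summable_mul_inner (h : IsEigenbasis v μ G T) :
    Summable fun j => μ j * ⟪v j, G (v j)⟫ := by
  simp_rw [h.inner_eq]
  exact (h.hasSum.summable.mul_left T).of_nonneg_of_le
    (fun j => mul_nonneg (h.nonneg j) (h.nonneg j))
    fun j => mul_le_mul_of_nonneg_right (h.le_trace j) (h.nonneg j)

variable {η q : ℕ → ℝ}

lemma contractedTrace_nonneg (hμ : ∀ j, 0 ≤ μ j) (hA : A.IsPositive) (s t : ℕ) :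
    0 ≤ contractedTrace v μ η s t A :=
  tsum_nonneg fun j =>
    mul_nonneg (mul_nonneg (hμ j) (sq_nonneg _)) (hA.inner_nonneg_right _)

lemma hasSum_contractedTrace (h0 : ∀ k j, 0 ≤ η k * μ j) (h1 : ∀ k j, η k * μ j ≤ 1)
    (hμ : ∀ j, 0 ≤ μ j) (hA : A.IsPositive) (hsum : Summable fun j => μ j * ⟪v j, A (v j)⟫)
    (s t : ℕ) :
    HasSum (fun j => μ j * decay η (μ j) s t ^ 2 * ⟪v j, A (v j)⟫)
      (contractedTrace v μ η s t A) := by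
  refine (hsum.of_nonneg_of_le (fun j => ?_) fun j => ?_).hasSum
  · exact mul_nonneg (mul_nonneg (hμ j) (sq_nonneg _)) (hA.inner_nonneg_right _)
  · exact mul_le_mul_of_nonneg_right (mul_le_of_le_one_right (hμ j)
      (decay_sq_le_one (h0 · j) (h1 · j) s t)) (hA.inner_nonneg_right _)

lemma hasSum_unrolledNoise (h0 : ∀ k j, 0 ≤ η k * μ j) (h1 : ∀ k j, η k * μ j ≤ 1)
    (hμ : ∀ j, 0 ≤ μ j) (hA : A.IsPositive) (hsum : Summable fun j => μ j * ⟪v j, A (v j)⟫)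
    (q : ℕ → ℝ) (t : ℕ) :
    HasSum (fun j => noiseGain η q (μ j) t * ⟪v j, A (v j)⟫) (unrolledNoise v μ η q t A) := by
  have hterm := hasSum_sum (s := Finset.range t) fun s _ =>
    (hasSum_contractedTrace h0 h1 hμ hA hsum (s + 1) t).mul_left (η s ^ 2 * q s)
  refine hterm.congr_fun fun j => ?_
  rw [noiseGain, Finset.sum_mul]
  exact Finset.sum_congr rfl fun s _ => by ring

lemma ofReal_unrolledNoise (h0 : ∀ k j, 0 ≤ η k * μ j) (h1 : ∀ k j, η k * μ j ≤ 1)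
    (hμ : ∀ j, 0 ≤ μ j) (hA : A.IsPositive) (hsum : Summable fun j => μ j * ⟪v j, A (v j)⟫)
    (hq : ∀ s, 0 ≤ q s) (t : ℕ) :
    ENNReal.ofReal (unrolledNoise v μ η q t A) =
      weightedTrace v (fun j => noiseGain η q (μ j) t) A := by
  have hnoise := hasSum_unrolledNoise h0 h1 hμ hA hsum q t
  rw [← hnoise.tsum_eq]
  refine ENNReal.ofReal_tsum_of_nonneg (fun j => mul_nonneg ?_ (hA.inner_nonneg_right _))
    hnoise.summable
  exact Finset.sum_nonneg fun s _ => mul_nonneg (mul_nonneg (sq_nonneg _) (hq s))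
    (mul_nonneg (hμ j) (sq_nonneg _))

lemma unrolledNoise_nonneg (hμ : ∀ j, 0 ≤ μ j) (hA : A.IsPositive) (hq : ∀ s, 0 ≤ q s) (t : ℕ) :
    0 ≤ unrolledNoise v μ η q t A :=
  Finset.sum_nonneg fun s _ => mul_nonneg (mul_nonneg (sq_nonneg _) (hq s))
    (contractedTrace_nonneg hμ hA _ _)

lemma IsEigenbasis.hasSum_contractedTrace (h : IsEigenbasis v μ G T)
    (h0 : ∀ k j, 0 ≤ η k * μ j) (h1 : ∀ k j, η k * μ j ≤ 1) (s t : ℕ) :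
    HasSum (fun j => μ j * decay η (μ j) s t ^ 2 * μ j) (contractedTrace v μ η s t G) := by
  simpa only [h.inner_eq] using
    CovShift.hasSum_contractedTrace h0 h1 h.nonneg h.isPositive h.summable_mul_inner s t

lemma IsEigenbasis.sum_mul_contractedTrace_le (h : IsEigenbasis v μ G T)
    (h0 : ∀ k j, 0 ≤ η k * μ j) (h1 : ∀ k j, η k * μ j ≤ 1) (F : Finset ℕ) (s t : ℕ → ℕ)
    (hF : ∀ j, ∑ i ∈ F, η i * μ j * decay η (μ j) (s i) (t i) ^ 2 ≤ 1) :
    ∑ i ∈ F, η i * contractedTrace v μ η (s i) (t i) G ≤ T := by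
  refine hasSum_le (fun j => ?_) (hasSum_sum fun i _ =>
    (h.hasSum_contractedTrace h0 h1 (s i) (t i)).mul_left (η i)) h.hasSum
  simp_rw [← mul_assoc]
  rw [← Finset.sum_mul]
  exact mul_le_of_le_one_left (h.nonneg j) (hF j)

lemma IsEigenbasis.sum_Ico_mul_contractedTrace_le_half (h : IsEigenbasis v μ G T)
    (h0 : ∀ k j, 0 ≤ η k * μ j) (h2 : ∀ k j, η k * μ j ≤ 1 / 2) {s t : ℕ} (hst : s < t) :
    (∑ k ∈ Finset.Ico s t, η k) * contractedTrace v μ η (s + 1) t G ≤ T / 2 := by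
  have h1 : ∀ k j, η k * μ j ≤ 1 := fun k j => (h2 k j).trans (by norm_num)
  rw [div_eq_inv_mul]
  refine hasSum_le (fun j => ?_) ((h.hasSum_contractedTrace h0 h1 (s + 1) t).mul_left _)
    (h.hasSum.mul_left _)
  rw [← mul_assoc, ← mul_assoc, ← one_div]
  exact mul_le_mul_of_nonneg_right
    (sum_Ico_mul_decay_succ_sq_le_half (h0 · j) (h2 · j) hst) (h.nonneg j)

lemma IsEigenbasis.sqNorm_contraction_antitone (h : IsEigenbasis v μ G T)
    (h0 : ∀ k j, 0 ≤ η k * μ j) (h1 : ∀ k j, η k * μ j ≤ 1) (u : E) :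
    Antitone fun t => sqNorm G (contraction η G t u) := fun s t hst => by
  refine hasSum_le (fun j => ?_) (hasSum_sqNorm_contraction h.isPositive h.eigen η t u)
    (hasSum_sqNorm_contraction h.isPositive h.eigen η s u)
  have hdecay := decay_antitone (h0 · j) (h1 · j) 0 hst
  have hdecay0 := decay_nonneg (h1 · j) 0 t
  have hμ := h.nonneg j
  gcongr

end Spectrum

section NoiseLevel

variable {E : Type*} [NormedAddCommGroup E] [InnerProductSpace ℝ E] {ι : Type*}
  {v : HilbertBasis ι ℝ E} {μ : ι → ℝ} {G : E →L[ℝ] E} {T : ℝ} {M : ℕ} {γ α σ : ℝ}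

lemma partialSum_mul_le_of_antitone {η p : ℕ → ℝ} (hη : ∀ k, 0 ≤ η k) (hp : ∀ k, 0 ≤ p k)
    (hanti : Antitone p) {s n : ℕ} (hs : s ≤ n) :
    (∑ k ∈ Finset.range s, η k) * p s ≤ ∑ k ∈ Finset.range n, η k * p k := by
  rw [Finset.sum_mul]
  exact (Finset.sum_le_sum fun k hk => mul_le_mul_of_nonneg_left
      (hanti (Finset.mem_range.1 hk).le) (hη k)).trans
    (Finset.sum_le_sum_of_subset_of_nonneg (Finset.range_subset_range.2 hs)
      fun k _ _ => mul_nonneg (hη k) (hp k))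

lemma sum_stepsize_mul_decay_sq_le (hM : 1 < M) (hγ : 0 < γ) (hμ : ∀ j, 0 ≤ μ j)
    (hγμ : ∀ j, γ * μ j ≤ 1) (J : Set ι) (j : ι) :
    ∑ t ∈ Finset.range M, stepsize M γ t * μ j * decay (stepsize M γ) (μ j) 0 t ^ 2 ≤
      4 * γ * effSamples M * headConstTail (1 / (effSamples M * γ)) μ J j := by
  have hm := effSamples_pos hM
  have h0 := stepsize_mul_nonneg (M := M) hγ (hμ j)
  have h1 := stepsize_mul_le (M := M) hγ (hμ j) (hγμ j)
  by_cases hj : j ∈ J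
  · have hweight : 4 * γ * effSamples M * (1 / (effSamples M * γ)) = 4 := by field_simp
    rw [headConstTail_of_mem _ _ hj, hweight, Finset.range_eq_Ico]
    exact (sum_Ico_mul_decay_sq_le_one h0 h1 (Nat.zero_le M)).trans (by norm_num)
  · rw [headConstTail_of_notMem _ _ hj]
    calc ∑ t ∈ Finset.range M, stepsize M γ t * μ j * decay (stepsize M γ) (μ j) 0 t ^ 2
      _ ≤ ∑ t ∈ Finset.range M, stepsize M γ t * μ j := Finset.sum_le_sum fun t _ =>
          mul_le_of_le_one_right (h0 t) (decay_sq_le_one h0 h1 0 t)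
      _ = (∑ t ∈ Finset.range M, stepsize M γ t) * μ j := by rw [Finset.sum_mul]
      _ ≤ 4 * γ * effSamples M * μ j :=
          mul_le_mul_of_nonneg_right (sum_range_stepsize_le hM hγ M) (hμ j)

variable [CompleteSpace E]

lemma IsEigenbasis.sum_stepsize_mul_sqNorm_le (h : IsEigenbasis v μ G T) (hM : 1 < M)
    (hγ : 0 < γ) (hγT : γ * T ≤ 1) (J : Set ι) (u : E) :
    ∑ t ∈ Finset.range M, stepsize M γ t * sqNorm G (contraction (stepsize M γ) G t u) ≤
      4 * γ * effSamples M *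
        ∑' j, headConstTail (1 / (effSamples M * γ)) μ J j * ⟪v j, u⟫ ^ 2 := by
  have hm := effSamples_pos hM
  have ha : 0 ≤ 1 / (effSamples M * γ) := by positivity
  have hsum := summable_mul_inner_sq v u (headConstTail_nonneg ha h.nonneg J)
    (headConstTail_le ha h.nonneg h.le_trace J)
  refine hasSum_le (fun j => ?_) (hasSum_sum fun t _ =>
    (hasSum_sqNorm_contraction h.isPositive h.eigen (stepsize M γ) t u).mul_left _)
    (hsum.hasSum.mul_left _)
  simp_rw [← mul_assoc]
  rw [← Finset.sum_mul]
  exact mul_le_mul_of_nonneg_right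
    (sum_stepsize_mul_decay_sq_le hM hγ h.nonneg (h.mul_le hγ.le hγT) J j) (sq_nonneg _)

/-- A bound for the noise covariance injected into the first `M` steps of the iteration, weighted
by the stepsizes: `4 γ m (α ‖u‖² + σ²)`, where `m` is the effective sample size and the norm of
the initial error `u` is the one of `I_J / (m γ) + G_{Jᶜ}`. -/
def noiseBudget (v : HilbertBasis ι ℝ E) (μ : ι → ℝ) (M : ℕ) (γ α σ : ℝ) (J : Set ι) (u : E) : ℝ :=
  4 * γ * effSamples M *
    (α * ∑' j, headConstTail (1 / (effSamples M * γ)) μ J j * ⟪v j, u⟫ ^ 2 + σ ^ 2)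

lemma IsEigenbasis.sum_stepsize_mul_forcing_le (h : IsEigenbasis v μ G T) (hM : 1 < M)
    (hγ : 0 < γ) (hγT : γ * T ≤ 1) (hα : 0 ≤ α) (J : Set ι) (u : E) :
    ∑ t ∈ Finset.range M, stepsize M γ t *
        (α * sqNorm G (contraction (stepsize M γ) G t u) + σ ^ 2) ≤
      noiseBudget v μ M γ α σ J u := by
  have hbias := mul_le_mul_of_nonneg_left (h.sum_stepsize_mul_sqNorm_le hM hγ hγT J u) hα
  have hvar := mul_le_mul_of_nonneg_right (sum_range_stepsize_le hM hγ M) (sq_nonneg σ)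
  have hsplit : ∑ t ∈ Finset.range M, stepsize M γ t *
      (α * sqNorm G (contraction (stepsize M γ) G t u) + σ ^ 2) =
      α * ∑ t ∈ Finset.range M, stepsize M γ t *
        sqNorm G (contraction (stepsize M γ) G t u) +
        (∑ t ∈ Finset.range M, stepsize M γ t) * σ ^ 2 := by
    rw [Finset.mul_sum, Finset.sum_mul, ← Finset.sum_add_distrib]
    exact Finset.sum_congr rfl fun t _ => by ring
  rw [hsplit, noiseBudget]
  linarith

lemma IsEigenbasis.noiseLevel_bounds (h : IsEigenbasis v μ G T) (hM : 1 < M) (hγ : 0 < γ)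
    (hα : 0 ≤ α) (hγT : γ * T ≤ 1 / 2) (hαT : 4 * α * γ * T ≤ 1) (J : Set ι) (u : E) {q : ℕ → ℝ}
    (hq : ∀ t, 0 ≤ q t)
    (hrec : ∀ t < M, q t ≤
      α * unrolledEnergy v μ G (stepsize M γ) (fun s => 2 * q s) u t G + σ ^ 2) :
    ∑ t ∈ Finset.range M, stepsize M γ t * q t ≤ 2 * noiseBudget v μ M γ α σ J u ∧
      ∀ s < M, (∑ k ∈ Finset.range s, stepsize M γ k) * q s ≤
        3 * noiseBudget v μ M γ α σ J u := by
  have hη := fun k => (stepsize_pos (M := M) hγ k).le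
  have h0 : ∀ k j, 0 ≤ stepsize M γ k * μ j := fun k j => stepsize_mul_nonneg hγ (h.nonneg j) k
  have h2 : ∀ k j, stepsize M γ k * μ j ≤ 1 / 2 := fun k j =>
    stepsize_mul_le hγ (h.nonneg j) (h.mul_le hγ.le hγT j) k
  have h1 : ∀ k j, stepsize M γ k * μ j ≤ 1 := fun k j => (h2 k j).trans (by norm_num)
  set p : ℕ → ℝ := fun t => α * sqNorm G (contraction (stepsize M γ) G t u) + σ ^ 2 with hp
  have hp0 : ∀ t, 0 ≤ p t := fun t =>
    add_nonneg (mul_nonneg hα (sqNorm_nonneg h.isPositive _)) (sq_nonneg σ)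
  have hanti : Antitone p := fun s t hst => add_le_add_left
    (mul_le_mul_of_nonneg_left (h.sqNorm_contraction_antitone h0 h1 u hst) hα) _
  have hsum : ∑ t ∈ Finset.range M, stepsize M γ t * p t ≤ noiseBudget v μ M γ α σ J u :=
    h.sum_stepsize_mul_forcing_le hM hγ (hγT.trans (by norm_num)) hα J u
  have hvolterra : ∀ s < M, q s ≤ p s + 2 * α * ∑ t ∈ Finset.range s, stepsize M γ t ^ 2 * q t *
      contractedTrace v μ (stepsize M γ) (t + 1) s G := fun s hs => by
    refine (hrec s hs).trans_eq ?_
    rw [unrolledEnergy, unrolledNoise_const_mul, unrolledNoise, hp]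
    ring
  have hqsum := volterra_sum_le hη (stepsize_le hγ) hα (h.hasSum.nonneg h.nonneg) hαT hq hvolterra
    hsum fun t ht => h.sum_mul_contractedTrace_le h0 h1 _ (fun _ => t + 1) (fun s => s)
      fun j => sum_Ico_mul_decay_sq_le_one (h0 · j) (h1 · j) ht
  refine ⟨hqsum, partialSum_mul_volterra_le hη (stepsize_le hγ) hα hαT hq
    (fun t s => contractedTrace_nonneg h.nonneg h.isPositive _ _)
    ((Finset.sum_nonneg fun t _ => mul_nonneg (hη t) (hp0 t)).trans hsum) hvolterra
    (fun s hs => (partialSum_mul_le_of_antitone hη hp0 hanti hs.le).trans hsum) hqsum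
    (fun s => h.sum_mul_contractedTrace_le h0 h1 _ (fun t => t + 1) (fun _ => s)
      fun j => sum_mul_decay_succ_sq_le_one (h0 · j) (h1 · j) s)
    fun t s hts => h.sum_Ico_mul_contractedTrace_le_half h0 h2 hts⟩

end NoiseLevel

section EffectiveDimension

variable {E : Type*} [NormedAddCommGroup E] [InnerProductSpace ℝ E] {ι : Type*}
  {v : HilbertBasis ι ℝ E} {μ : ι → ℝ} {M : ℕ} {γ : ℝ} {q : ℕ → ℝ} {J : Set ι} {j : ι}

lemma noiseGain_le_headInvTail (hM : 1 < M) (hγ : 0 < γ) (hμ : 0 < μ j) (hγμ : γ * μ j ≤ 1)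
    (hq : ∀ t, 0 ≤ q t) {Q : ℝ} (hQ : 0 ≤ Q) (J : Set ι)
    (hsum : ∑ t ∈ Finset.range M, stepsize M γ t * q t ≤ 2 * Q)
    (hpt : ∀ t < M, (∑ k ∈ Finset.range t, stepsize M γ k) * q t ≤ 3 * Q) :
    noiseGain (stepsize M γ) q (μ j) M ≤
      44 * Q / (γ * effSamples M ^ 2) * headInvTail (effSamples M ^ 2 * γ ^ 2) μ J j := by
  have hm := effSamples_pos hM
  by_cases hj : j ∈ J
  · refine (noiseGain_le_of_sum_mul_le hM hγ hμ hγμ hq hsum hpt).trans_eq ?_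
    rw [headInvTail_of_mem _ _ hj]
    field_simp; ring
  · refine (noiseGain_le_of_sum_le hγ hμ.le hγμ hq hsum).trans ?_
    have hweight : 44 * Q / (γ * effSamples M ^ 2) * (effSamples M ^ 2 * γ ^ 2 * μ j) =
        44 * (γ * μ j * Q) := by field_simp
    rw [headInvTail_of_notMem _ _ hj, hweight]
    linarith [mul_nonneg (mul_nonneg hγ.le hμ.le) hQ]

lemma headInvTail_le_noiseGain (hM : 1 < M) (hγ : 0 < γ) (hμ : 0 < μ j) (hγμ : γ * μ j ≤ 1 / 2)
    {κ : ℝ} (hκ : 0 ≤ κ) (hq : ∀ t < M, κ ≤ q t) :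
    Real.exp (-32) / 2 * κ / effSamples M * headInvTail (effSamples M ^ 2 * γ ^ 2) μ
        {i | 1 / (γ * effSamples M) ≤ μ i} j ≤
      noiseGain (stepsize M γ) q (μ j) M := by
  have hm := effSamples_pos hM
  have hmem : j ∈ {i | 1 / (γ * effSamples M) ≤ μ i} ↔ 1 ≤ γ * μ j * effSamples M := by
    rw [Set.mem_ofPred_eq, div_le_iff₀ (by positivity), mul_right_comm, mul_comm (μ j)]
  by_cases hj : j ∈ {i | 1 / (γ * effSamples M) ≤ μ i}
  · refine le_of_eq_of_le ?_ (le_noiseGain_of_one_le hM hγ hμ hγμ hκ hq (hmem.1 hj))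
    rw [headInvTail_of_mem _ _ hj]
    field_simp
  · refine le_trans ?_ (le_noiseGain_of_le_one hM hγ hμ.le hγμ hκ hq
      (not_le.1 (mt hmem.2 hj)).le)
    have hweight : Real.exp (-32) / 2 * κ / effSamples M *
        (effSamples M ^ 2 * γ ^ 2 * μ j) =
        Real.exp (-32) / 2 * κ * (effSamples M * γ ^ 2 * μ j) := by field_simp
    rw [headInvTail_of_notMem _ _ hj, hweight]
    gcongr
    norm_num

end EffectiveDimension

section SpectralBounds

variable {E : Type*} [NormedAddCommGroup E] [InnerProductSpace ℝ E] {ι : Type*}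
  {v : HilbertBasis ι ℝ E} {μ : ι → ℝ} {G H : E →L[ℝ] E} {T : ℝ} {M : ℕ} {γ : ℝ} {q : ℕ → ℝ}

lemma IsEigenbasis.ofReal_unrolledNoise_stepsize (h : IsEigenbasis v μ G T) (hγ : 0 < γ)
    (hγT : γ * T ≤ 1) (hH : H.IsPositive) (hsum : Summable fun j => μ j * ⟪v j, H (v j)⟫)
    (hq : ∀ t, 0 ≤ q t) :
    ENNReal.ofReal (unrolledNoise v μ (stepsize M γ) q M H) =
      weightedTrace v (fun j => noiseGain (stepsize M γ) q (μ j) M) H :=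
  ofReal_unrolledNoise (fun k j => stepsize_mul_nonneg hγ (h.nonneg j) k)
    (fun k j => stepsize_mul_le hγ (h.nonneg j) (h.mul_le hγ.le hγT j) k) h.nonneg hH hsum hq M

lemma IsEigenbasis.ofReal_unrolledNoise_le (h : IsEigenbasis v μ G T) (hM : 1 < M) (hγ : 0 < γ)
    (hγT : γ * T ≤ 1) (hH : H.IsPositive) (hsum : Summable fun j => μ j * ⟪v j, H (v j)⟫)
    (hq : ∀ t, 0 ≤ q t) {Q : ℝ} (hQ : 0 ≤ Q) (J : Set ι)
    (hqsum : ∑ t ∈ Finset.range M, stepsize M γ t * q t ≤ 2 * Q)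
    (hqpt : ∀ t < M, (∑ k ∈ Finset.range t, stepsize M γ k) * q t ≤ 3 * Q) :
    ENNReal.ofReal (unrolledNoise v μ (stepsize M γ) q M H) ≤
      ENNReal.ofReal (44 * Q / (γ * effSamples M ^ 2)) * effDim v μ J H (effSamples M) γ := by
  rw [h.ofReal_unrolledNoise_stepsize hγ hγT hH hsum hq, effDim_eq_weightedTrace v h.nonneg J hH,
    ← weightedTrace_const_mul v (by positivity)]
  exact weightedTrace_mono v (fun j =>
    noiseGain_le_headInvTail hM hγ (h.pos j) (h.mul_le hγ.le hγT j) hq hQ J hqsum hqpt) hH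

lemma IsEigenbasis.le_ofReal_unrolledNoise (h : IsEigenbasis v μ G T) (hM : 1 < M) (hγ : 0 < γ)
    (hγT : γ * T ≤ 1 / 2) (hH : H.IsPositive) (hsum : Summable fun j => μ j * ⟪v j, H (v j)⟫)
    (hq : ∀ t, 0 ≤ q t) {κ : ℝ} (hκ : 0 ≤ κ) (hκq : ∀ t < M, κ ≤ q t) :
    ENNReal.ofReal (Real.exp (-32) / 2 * κ / effSamples M) *
        effDim v μ {j | 1 / (γ * effSamples M) ≤ μ j} H (effSamples M) γ ≤
      ENNReal.ofReal (unrolledNoise v μ (stepsize M γ) q M H) := by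
  have hm := effSamples_pos hM
  rw [h.ofReal_unrolledNoise_stepsize hγ (hγT.trans (by norm_num)) hH hsum hq,
    effDim_eq_weightedTrace v h.nonneg _ hH, ← weightedTrace_const_mul v (by positivity)]
  exact weightedTrace_mono v (fun j =>
    headInvTail_le_noiseGain hM hγ (h.pos j) (h.mul_le hγ.le hγT j) hκ hκq) hH

lemma IsEigenbasis.le_sqNorm_contraction [CompleteSpace E] (h : IsEigenbasis v μ G T) (hM : 1 < M)
    (hγ : 0 < γ) (hγT : γ * T ≤ 1 / 2) (u : E) (t : ℕ) :
    Real.exp (-16) * ∑' j, tail μ {j | 1 / (γ * effSamples M) ≤ μ j} j * ⟪v j, u⟫ ^ 2 ≤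
      sqNorm G (contraction (stepsize M γ) G t u) := by
  have hm := effSamples_pos hM
  set J := {j | 1 / (γ * effSamples M) ≤ μ j} with hJ
  refine hasSum_le (fun j => ?_) ((summable_mul_inner_sq v u (tail_nonneg h.nonneg J)
      (tail_le h.nonneg h.le_trace J)).hasSum.mul_left _)
    (hasSum_sqNorm_contraction h.isPositive h.eigen (stepsize M γ) t u)
  rw [← mul_assoc]
  refine mul_le_mul_of_nonneg_right ?_ (sq_nonneg _)
  by_cases hj : j ∈ J
  · rw [tail, Set.indicator_of_notMem (not_not.2 hj), mul_zero]
    exact mul_nonneg (h.nonneg j) (sq_nonneg _)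
  · have hsmall : μ j * (γ * effSamples M) < 1 := by
      rw [hJ, Set.mem_ofPred_eq, not_le, lt_div_iff₀ (by positivity)] at hj
      exact hj
    have hdecay := exp_le_decay_sq hM hγ (h.nonneg j) (h.mul_le hγ.le hγT j) (c := 1) (s := 0)
      (by
        have := mul_le_mul_of_nonneg_left
          (stepsize_mul_le (M := M) hγ (h.nonneg j) le_rfl 0) hm.le
        linarith) t
    rw [mul_one] at hdecay
    rw [tail, Set.indicator_of_mem (Set.mem_compl hj), mul_comm]
    exact mul_le_mul_of_nonneg_left hdecay (h.nonneg j)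

end SpectralBounds

section SourceSpectrum

variable {E : Type*} [NormedAddCommGroup E] [InnerProductSpace ℝ E] [CompleteSpace E]
  [SecondCountableTopology E] [MeasurableSpace E] [BorelSpace E] {D : Measure (E × ℝ)}
  {ι : Type*} {v : HilbertBasis ι ℝ E} {μ : ι → ℝ} {α γ : ℝ}

lemma isEigenbasis_secondMoment (h2 : FiniteSecondMoments D)
    (hpos : StrictlyPositive (secondMoment D)) (hv : ∀ j, secondMoment D (v j) = μ j • v j) :
    IsEigenbasis v μ (secondMoment D) (trace (secondMoment D)) := by
  have hμ : ∀ j, ⟪v j, secondMoment D (v j)⟫ = μ j := fun j => by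
    rw [hv, inner_smul_right, real_inner_self_eq_norm_sq, v.orthonormal.1, one_pow, mul_one]
  refine ⟨secondMoment_isPositive h2.covariate, hv, fun j => ?_, ?_⟩
  · rw [← hμ]
    exact hpos _ (v.orthonormal.ne_zero j)
  · have htrace := hasSum_inner_secondMoment_comp h2.covariate (ContinuousLinearMap.id ℝ E) v
    simp only [ContinuousLinearMap.id_apply, hμ, real_inner_self_eq_norm_sq] at htrace
    rwa [trace_secondMoment h2.covariate]

lemma hasSum_mul_inner (h2 : FiniteSecondMoments D)
    (hv : ∀ j, secondMoment D (v j) = μ j • v j) (A : E →L[ℝ] E) :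
    HasSum (fun j => μ j * ⟪v j, A (v j)⟫) (∫ p, ⟪p.1, A p.1⟫ ∂D) := by
  refine (hasSum_inner_secondMoment_comp h2.covariate A v).congr_fun fun j => ?_
  rw [← (secondMoment_isPositive h2.covariate).inner_left_eq_inner_right, hv, inner_smul_left,
    conj_trivial]

lemma IsEigenbasis.one_le_of_fourthMomentUpper [IsProbabilityMeasure D] {T : ℝ}
    (h : IsEigenbasis v μ (secondMoment D) T) (hT : 0 < T) (h2 : FiniteSecondMoments D)
    (h4 : FourthMomentUpper D α) : 1 ≤ α := by
  obtain ⟨j⟩ : Nonempty ι := by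
    by_contra! hι
    exact hT.ne (hasSum_empty.unique h.hasSum)
  exact h4.one_le h2 (u := v j) (by rw [h.inner_eq]; exact h.pos j)

lemma IsEigenbasis.stepsize_bounds [IsProbabilityMeasure D] {T : ℝ}
    (h : IsEigenbasis v μ (secondMoment D) T) (h2 : FiniteSecondMoments D)
    (h4 : FourthMomentUpper D α) (hγ : 0 < γ) (hγα : γ < 1 / (4 * α * T)) :
    0 ≤ α ∧ 4 * α * γ * T ≤ 1 ∧ γ * T ≤ 1 / 2 := by
  have hαT : 0 < 4 * α * T := one_div_pos.1 (hγ.trans hγα)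
  have hT : 0 < T := (h.hasSum.nonneg h.nonneg).lt_of_ne' (right_ne_zero_of_mul hαT.ne')
  have hα := h.one_le_of_fourthMomentUpper hT h2 h4
  rw [lt_div_iff₀ hαT] at hγα
  refine ⟨zero_le_one.trans hα, by linarith, ?_⟩
  linarith [le_mul_of_one_le_left (mul_pos hγ hT).le hα]

end SourceSpectrum

section EnergyBounds

variable {E : Type*} [NormedAddCommGroup E] [InnerProductSpace ℝ E] [CompleteSpace E]
  [SecondCountableTopology E] [MeasurableSpace E] [BorelSpace E] {D : Measure (E × ℝ)}
  [IsProbabilityMeasure D] {wStar : E} {ι : Type*} {v : HilbertBasis ι ℝ E} {μ : ι → ℝ}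
  {T α β γ σ : ℝ} {M : ℕ} {Ω : Type*} [MeasurableSpace Ω] {P : Measure Ω} [IsProbabilityMeasure P]
  {Z : ℕ → Ω → E × ℝ} {A : E →L[ℝ] E}
  (hZ : ∀ t < M, HasLaw (Z t) D P) (hi : iIndepFun (fun t : Fin M => Z t) P)
  (h2 : FiniteSecondMoments D) (hmin : ∀ w, risk D wStar ≤ risk D w)
  (h4 : FourthMomentUpper D α) (hα : 0 ≤ α) (hn : NoiseBound D wStar σ)
include hZ hi h2 hmin h4 hα hn

lemma energy_toReal_le (hv : ∀ j, secondMoment D (v j) = μ j • v j) (η : ℕ → ℝ) (w₀ : E) {t : ℕ}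
    (ht : t ≤ M) (hA : IsSecondMoment A) :
    (energy P Z η w₀ wStar t A).toReal ≤ unrolledEnergy v μ (secondMoment D) η
      (fun s => 2 * (α * (energy P Z η w₀ wStar s (secondMoment D)).toReal + σ ^ 2))
      (w₀ - wStar) t A := by
  induction t generalizing A with
  | zero =>
    rw [energy_zero, unrolledEnergy_zero, ENNReal.toReal_ofReal (sqNorm_nonneg hA.isPositive _)]
  | succ t ih =>
    have hG := isSecondMoment_secondMoment h2.covariate
    have hA' := hA.congruence (ContinuousLinearMap.id ℝ E - η t • secondMoment D)
    have hfinA := energy_ne_top hZ hi h2 hmin h4 hα hn η w₀ (Nat.le_of_lt ht) hA'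
    have hfinG := energy_ne_top hZ hi h2 hmin h4 hα hn η w₀ (Nat.le_of_lt ht) hG
    have htrace : 0 ≤ ∫ p, ⟪p.1, A p.1⟫ ∂D := integral_nonneg fun p =>
      hA.isPositive.inner_nonneg_right p.1
    have hstep := ENNReal.toReal_mono (by finiteness)
      (energy_succ_le hZ hi h2 hmin h4 hα hn hA η w₀ ht)
    rw [ENNReal.toReal_add hfinA (by finiteness), ENNReal.toReal_mul,
      ENNReal.toReal_add (by finiteness) (by finiteness), ENNReal.toReal_mul,
      ENNReal.toReal_ofReal (by positivity), ENNReal.toReal_ofReal hα,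
      ENNReal.toReal_ofReal (sq_nonneg σ)] at hstep
    rw [unrolledEnergy_succ hv, (hasSum_mul_inner h2 hv A).tsum_eq]
    linarith [ih (Nat.le_of_lt ht) hA']

lemma le_energy_toReal (hl : FourthMomentLower D β) (hβ : 0 ≤ β) (hw : WellSpecified D wStar σ)
    (hv : ∀ j, secondMoment D (v j) = μ j • v j) (η : ℕ → ℝ) (w₀ : E) {t : ℕ} (ht : t ≤ M)
    (hA : IsSecondMoment A) :
    unrolledEnergy v μ (secondMoment D) η
      (fun s => β * (energy P Z η w₀ wStar s (secondMoment D)).toReal + σ ^ 2)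
      (w₀ - wStar) t A ≤ (energy P Z η w₀ wStar t A).toReal := by
  induction t generalizing A with
  | zero =>
    rw [energy_zero, unrolledEnergy_zero, ENNReal.toReal_ofReal (sqNorm_nonneg hA.isPositive _)]
  | succ t ih =>
    have hG := isSecondMoment_secondMoment h2.covariate
    have hA' := hA.congruence (ContinuousLinearMap.id ℝ E - η t • secondMoment D)
    have hfinA := energy_ne_top hZ hi h2 hmin h4 hα hn η w₀ (Nat.le_of_lt ht) hA'
    have hfinG := energy_ne_top hZ hi h2 hmin h4 hα hn η w₀ (Nat.le_of_lt ht) hG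
    have htrace : 0 ≤ ∫ p, ⟪p.1, A p.1⟫ ∂D := integral_nonneg fun p =>
      hA.isPositive.inner_nonneg_right p.1
    have hstep := ENNReal.toReal_mono (energy_ne_top hZ hi h2 hmin h4 hα hn η w₀ ht hA)
      (le_energy_succ hZ hi h2 hmin hl hβ hn.integrable hw hA η w₀ ht)
    rw [ENNReal.toReal_add hfinA (by finiteness), ENNReal.toReal_mul,
      ENNReal.toReal_add (by finiteness) (by finiteness), ENNReal.toReal_mul,
      ENNReal.toReal_ofReal (by positivity), ENNReal.toReal_ofReal hβ,
      ENNReal.toReal_ofReal (sq_nonneg σ)] at hstep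
    rw [unrolledEnergy_succ hv, (hasSum_mul_inner h2 hv A).tsum_eq]
    linarith [ih (Nat.le_of_lt ht) hA']

variable (h : IsEigenbasis v μ (secondMoment D) T) (hM : 1 < M) (hγ : 0 < γ) (hγT : γ * T ≤ 1 / 2)
include h hM hγ hγT

lemma energy_le (hαT : 4 * α * γ * T ≤ 1) (w₀ : E) (J : Set ι) (hA : IsSecondMoment A) :
    energy P Z (stepsize M γ) w₀ wStar M A ≤
      ENNReal.ofReal (sqNorm A (contraction (stepsize M γ) (secondMoment D) M (w₀ - wStar))) +
        ENNReal.ofReal (88 * noiseBudget v μ M γ α σ J (w₀ - wStar) / (γ * effSamples M ^ 2)) *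
          effDim v μ J A (effSamples M) γ := by
  set q : ℕ → ℝ := fun s =>
    α * (energy P Z (stepsize M γ) w₀ wStar s (secondMoment D)).toReal + σ ^ 2
  have hq : ∀ t, 0 ≤ q t := fun t => by positivity
  have hbound : ∀ {t : ℕ}, t ≤ M → ∀ {B : E →L[ℝ] E}, IsSecondMoment B →
      (energy P Z (stepsize M γ) w₀ wStar t B).toReal ≤
        unrolledEnergy v μ (secondMoment D) (stepsize M γ) (fun s => 2 * q s) (w₀ - wStar) t B :=
    fun ht _ hB => energy_toReal_le hZ hi h2 hmin h4 hα hn h.eigen (stepsize M γ) w₀ ht hB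
  obtain ⟨hqsum, hqpt⟩ := h.noiseLevel_bounds (σ := σ) hM hγ hα hγT hαT J (w₀ - wStar) hq
    fun t ht => add_le_add_left (mul_le_mul_of_nonneg_left
      (hbound ht.le (isSecondMoment_secondMoment h2.covariate)) hα) _
  have hbudget : 0 ≤ noiseBudget v μ M γ α σ J (w₀ - wStar) := by
    have := Finset.sum_nonneg fun t (_ : t ∈ Finset.range M) =>
      mul_nonneg (stepsize_pos (M := M) hγ t).le (hq t)
    linarith
  have hnoise := h.ofReal_unrolledNoise_le hM hγ (hγT.trans (by norm_num)) hA.isPositive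
    (hasSum_mul_inner h2 h.eigen A).summable hq hbudget J hqsum hqpt
  rw [← ENNReal.ofReal_toReal (energy_ne_top hZ hi h2 hmin h4 hα hn _ w₀ le_rfl hA)]
  refine (ENNReal.ofReal_le_ofReal (hbound le_rfl hA)).trans (ENNReal.ofReal_add_le.trans ?_)
  gcongr
  rw [unrolledNoise_const_mul, ENNReal.ofReal_mul zero_le_two]
  refine (mul_le_mul_right hnoise _).trans_eq ?_
  rw [← mul_assoc, ← ENNReal.ofReal_mul zero_le_two]
  congr 2
  ring

lemma le_noiseLevel (hl : FourthMomentLower D β) (hβ : 0 ≤ β) (hw : WellSpecified D wStar σ)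
    (w₀ : E) {t : ℕ} (ht : t ≤ M) :
    Real.exp (-16) * (β * ∑' j, tail μ {j | 1 / (γ * effSamples M) ≤ μ j} j *
        ⟪v j, w₀ - wStar⟫ ^ 2 + σ ^ 2) ≤
      β * (energy P Z (stepsize M γ) w₀ wStar t (secondMoment D)).toReal + σ ^ 2 := by
  have hcontraction : sqNorm (secondMoment D)
      (contraction (stepsize M γ) (secondMoment D) t (w₀ - wStar)) ≤
        (energy P Z (stepsize M γ) w₀ wStar t (secondMoment D)).toReal :=
    (le_add_of_nonneg_right (unrolledNoise_nonneg h.nonneg h.isPositive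
      (fun _ => by positivity) t)).trans
      (le_energy_toReal hZ hi h2 hmin h4 hα hn hl hβ hw h.eigen (stepsize M γ) w₀ ht
        (isSecondMoment_secondMoment h2.covariate))
  have hbias := mul_le_mul_of_nonneg_left
    ((h.le_sqNorm_contraction hM hγ hγT (w₀ - wStar) t).trans hcontraction) hβ
  have hvar : Real.exp (-16) * σ ^ 2 ≤ σ ^ 2 :=
    mul_le_of_le_one_left (sq_nonneg σ) (Real.exp_le_one_iff.2 (by norm_num))
  linarith

lemma le_energy (hl : FourthMomentLower D β) (hβ : 0 ≤ β) (hw : WellSpecified D wStar σ)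
    (w₀ : E) (hA : IsSecondMoment A) :
    ENNReal.ofReal (sqNorm A (contraction (stepsize M γ) (secondMoment D) M (w₀ - wStar))) +
        ENNReal.ofReal (Real.exp (-48) / 2 *
            (β * ∑' j, tail μ {j | 1 / (γ * effSamples M) ≤ μ j} j * ⟪v j, w₀ - wStar⟫ ^ 2 +
              σ ^ 2) / effSamples M) *
          effDim v μ {j | 1 / (γ * effSamples M) ≤ μ j} A (effSamples M) γ ≤
      energy P Z (stepsize M γ) w₀ wStar M A := by
  set J : Set ι := {j | 1 / (γ * effSamples M) ≤ μ j}
  set x := β * ∑' j, tail μ J j * ⟪v j, w₀ - wStar⟫ ^ 2 + σ ^ 2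
  have hx0 : 0 ≤ x := add_nonneg (mul_nonneg hβ (tsum_nonneg fun j =>
    mul_nonneg (tail_nonneg h.nonneg J j) (sq_nonneg _))) (sq_nonneg σ)
  set q : ℕ → ℝ := fun s =>
    β * (energy P Z (stepsize M γ) w₀ wStar s (secondMoment D)).toReal + σ ^ 2
  have hq : ∀ t, 0 ≤ q t := fun t => by positivity
  have hnoise := h.le_ofReal_unrolledNoise hM hγ hγT hA.isPositive
    (hasSum_mul_inner h2 h.eigen A).summable hq (κ := Real.exp (-16) * x) (by positivity)
    fun t ht => le_noiseLevel hZ hi h2 hmin h4 hα hn h hM hγ hγT hl hβ hw w₀ ht.le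
  have hexp : Real.exp (-48) / 2 * x = Real.exp (-32) / 2 * (Real.exp (-16) * x) := by
    rw [show (-48 : ℝ) = -32 + -16 by norm_num, Real.exp_add]
    ring
  rw [hexp, ← ENNReal.ofReal_toReal (energy_ne_top hZ hi h2 hmin h4 hα hn _ w₀ le_rfl hA)]
  refine (add_le_add_right hnoise _).trans ?_
  rw [← ENNReal.ofReal_add (sqNorm_nonneg hA.isPositive _)
    (unrolledNoise_nonneg h.nonneg hA.isPositive hq M)]
  exact ENNReal.ofReal_le_ofReal
    (le_energy_toReal hZ hi h2 hmin h4 hα hn hl hβ hw h.eigen (stepsize M γ) w₀ le_rfl hA)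

end EnergyBounds

section ExcessRisk

lemma ofReal_mul_weightedSq_add {E : Type*} [NormedAddCommGroup E] [InnerProductSpace ℝ E]
    [CompleteSpace E] {ι : Type*} (v : HilbertBasis ι ℝ E) (u : E) {φ : ι → ℝ} {a b c : ℝ}
    (ha : 0 ≤ a) (hb : 0 ≤ b) (h0 : ∀ j, 0 ≤ φ j) (hc : ∀ j, φ j ≤ c) :
    ENNReal.ofReal a * weightedSq v φ u + ENNReal.ofReal b =
      ENNReal.ofReal (a * ∑' j, φ j * ⟪v j, u⟫ ^ 2 + b) := by
  have hsum : 0 ≤ ∑' j, φ j * ⟪v j, u⟫ ^ 2 :=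
    tsum_nonneg fun j => mul_nonneg (h0 j) (sq_nonneg _)
  rw [weightedSq_eq_ofReal v u h0 hc, ← ENNReal.ofReal_mul ha,
    ← ENNReal.ofReal_add (mul_nonneg ha hsum) hb]

lemma ofReal_mul_div_mul {a m : ℝ} (ha : 0 ≤ a) (hm : 0 < m) (x : ℝ) (d : ℝ≥0∞) :
    ENNReal.ofReal (a * x / m) * d =
      ENNReal.ofReal a * (ENNReal.ofReal x * (d / ENNReal.ofReal m)) := by
  rw [ENNReal.ofReal_div_of_pos hm, ENNReal.ofReal_mul ha]
  simp only [div_eq_mul_inv]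
  ring

variable {E : Type*} [NormedAddCommGroup E] [InnerProductSpace ℝ E] [CompleteSpace E]
  [SecondCountableTopology E] [MeasurableSpace E] [BorelSpace E] {DS DT : Measure (E × ℝ)}
  {wStar : E} {ι : Type*} {v : HilbertBasis ι ℝ E} {μ : ι → ℝ}
  {T α β γ σ : ℝ} {M : ℕ} {Ω : Type*} [MeasurableSpace Ω] {P : Measure Ω}
  {Z : ℕ → Ω → E × ℝ}

lemma lintegral_excessRisk (hT2 : FiniteSecondMoments DT)
    (hTmin : ∀ w, risk DT wStar ≤ risk DT w) (η : ℕ → ℝ) (w₀ : E) (t : ℕ) :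
    ∫⁻ ω, ENNReal.ofReal (excessRisk DT wStar (sgd η w₀ (fun k => Z k ω) t)) ∂P =
      ENNReal.ofReal (1 / 2) * energy P Z η w₀ wStar t (secondMoment DT) := by
  rw [energy, ← lintegral_const_mul' _ _ ENNReal.ofReal_ne_top]
  refine lintegral_congr fun ω => ?_
  rw [excessRisk_eq hT2 hTmin, ENNReal.ofReal_mul (by norm_num)]

variable [IsProbabilityMeasure DS] [SFinite DT] [IsProbabilityMeasure P]
  (hZ : ∀ t < M, HasLaw (Z t) DS P) (hi : iIndepFun (fun t : Fin M => Z t) P)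
  (h2 : FiniteSecondMoments DS) (hmin : ∀ w, risk DS wStar ≤ risk DS w)
  (h4 : FourthMomentUpper DS α) (hα : 0 ≤ α) (hn : NoiseBound DS wStar σ)
  (h : IsEigenbasis v μ (secondMoment DS) T) (hM : 1 < M) (hγ : 0 < γ) (hγT : γ * T ≤ 1 / 2)
  (hT2 : FiniteSecondMoments DT) (hTmin : ∀ w, risk DT wStar ≤ risk DT w)
include hZ hi h2 hmin h4 hα hn h hM hγ hγT hT2 hTmin

lemma lintegral_excessRisk_le (hαT : 4 * α * γ * T ≤ 1) (w₀ : E) (J : Set ι) :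
    ∫⁻ ω, ENNReal.ofReal (excessRisk DT wStar (sgd (stepsize M γ) w₀ (fun t => Z t ω) M)) ∂P ≤
      ENNReal.ofReal 176 * (ENNReal.ofReal (sqNorm (secondMoment DT)
          (contraction (stepsize M γ) (secondMoment DS) M (w₀ - wStar))) +
        (ENNReal.ofReal α * weightedSq v (headConstTail (1 / (effSamples M * γ)) μ J)
            (w₀ - wStar) + ENNReal.ofReal (σ ^ 2)) *
          (effDim v μ J (secondMoment DT) (effSamples M) γ / ENNReal.ofReal (effSamples M))) := by
  have hm := effSamples_pos hM
  have ha : 0 ≤ 1 / (effSamples M * γ) := by positivity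
  have henergy := energy_le hZ hi h2 hmin h4 hα hn h hM hγ hγT hαT w₀ J
    (isSecondMoment_secondMoment hT2.covariate)
  have hbudget : 88 * noiseBudget v μ M γ α σ J (w₀ - wStar) / (γ * effSamples M ^ 2) =
      352 * (α * ∑' j, headConstTail (1 / (effSamples M * γ)) μ J j * ⟪v j, w₀ - wStar⟫ ^ 2 +
        σ ^ 2) / effSamples M := by
    rw [noiseBudget]
    field
  rw [hbudget, ofReal_mul_div_mul (by norm_num) hm] at henergy
  rw [lintegral_excessRisk hT2 hTmin, ofReal_mul_weightedSq_add v _ hα (sq_nonneg σ)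
    (headConstTail_nonneg ha h.nonneg J) (headConstTail_le ha h.nonneg h.le_trace J)]
  refine (mul_le_mul_right (henergy.trans (add_le_add_left
    (le_mul_of_one_le_left' (ENNReal.one_le_ofReal.2 (by norm_num : (1 : ℝ) ≤ 352))) _))
    _).trans_eq ?_
  rw [← mul_add, ← mul_assoc, ← ENNReal.ofReal_mul (by norm_num)]
  norm_num

lemma le_lintegral_excessRisk (hl : FourthMomentLower DS β) (hβ : 0 ≤ β)
    (hw : WellSpecified DS wStar σ) (w₀ : E) {J : Set ι}
    (hJ : J = {j | 1 / (γ * effSamples M) ≤ μ j}) :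
    ENNReal.ofReal (Real.exp (-48) / 4) * (ENNReal.ofReal (sqNorm (secondMoment DT)
          (contraction (stepsize M γ) (secondMoment DS) M (w₀ - wStar))) +
        (ENNReal.ofReal β * weightedSq v (tail μ J) (w₀ - wStar) + ENNReal.ofReal (σ ^ 2)) *
          (effDim v μ J (secondMoment DT) (effSamples M) γ / ENNReal.ofReal (effSamples M))) ≤
      ∫⁻ ω, ENNReal.ofReal
        (excessRisk DT wStar (sgd (stepsize M γ) w₀ (fun t => Z t ω) M)) ∂P := by
  subst hJ
  have henergy := le_energy hZ hi h2 hmin h4 hα hn h hM hγ hγT hl hβ hw w₀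
    (isSecondMoment_secondMoment hT2.covariate)
  rw [ofReal_mul_div_mul (by positivity) (effSamples_pos hM)] at henergy
  have hexp : Real.exp (-48) / 2 ≤ 1 := by
    linarith [Real.exp_le_one_iff.2 (show (-48 : ℝ) ≤ 0 by norm_num)]
  rw [lintegral_excessRisk hT2 hTmin, ofReal_mul_weightedSq_add v _ hβ (sq_nonneg σ)
    (tail_nonneg h.nonneg _) (tail_le h.nonneg h.le_trace _),
    show Real.exp (-48) / 4 = 1 / 2 * (Real.exp (-48) / 2) by ring,
    ENNReal.ofReal_mul (by norm_num), mul_assoc, mul_add (ENNReal.ofReal (Real.exp (-48) / 2))]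
  exact mul_le_mul_right ((add_le_add_left
    (mul_le_of_le_one_left' (ENNReal.ofReal_le_one.2 hexp)) _).trans henergy) _

end ExcessRisk

end CovShift

end

theorem corollary3_general :
    ∃ C c : ℝ≥0, 0 < C ∧ 0 < c ∧
      ∀ (E : Type*) [NormedAddCommGroup E] [InnerProductSpace ℝ E] [CompleteSpace E]
        [SecondCountableTopology E] [MeasurableSpace E] [BorelSpace E]
        (DS DT : Measure (E × ℝ)) [IsProbabilityMeasure DS] [SFinite DT]
        (wStar : E) (_ : CovShift.FiniteSecondMoments DS) (_ : CovShift.FiniteSecondMoments DT)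
        (_ : CovShift.StrictlyPositive (CovShift.secondMoment DS))
        (_ : ∀ w, CovShift.risk DS wStar ≤ CovShift.risk DS w)
        (_ : ∀ w, CovShift.risk DT wStar ≤ CovShift.risk DT w)
        (ι : Type*) (v : HilbertBasis ι ℝ E) (μ : ι → ℝ)
        (_ : ∀ j, CovShift.secondMoment DS (v j) = μ j • v j)
        (α σ : ℝ) (_ : CovShift.FourthMomentUpper DS α) (_ : CovShift.NoiseBound DS wStar σ)
        (M : ℕ) (_ : 1 < M)
        (γ : ℝ) (_ : 0 < γ) (_ : γ < 1 / (4 * α * CovShift.trace (CovShift.secondMoment DS)))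
        (Ω : Type*) [MeasurableSpace Ω] (P : Measure Ω) (Z : ℕ → Ω → E × ℝ)
        (_ : ∀ t < M, HasLaw (Z t) DS P) (_ : iIndepFun (fun t : Fin M => Z t) P)
        (w₀ : E),
        (∀ J : Set ι,
          ∫⁻ ω, ENNReal.ofReal (CovShift.excessRisk DT wStar
              (CovShift.sgd (CovShift.stepsize M γ) w₀ (fun t => Z t ω) M)) ∂P ≤
            C * (ENNReal.ofReal
                  (CovShift.sqNorm (CovShift.secondMoment DT)
                    (CovShift.contraction (CovShift.stepsize M γ) (CovShift.secondMoment DS) M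
                      (w₀ - wStar))) +
                (ENNReal.ofReal α *
                    CovShift.weightedSq v
                      (CovShift.headConstTail (1 / (CovShift.effSamples M * γ)) μ J)
                      (w₀ - wStar) +
                  ENNReal.ofReal (σ ^ 2)) *
                (CovShift.effDim v μ J (CovShift.secondMoment DT) (CovShift.effSamples M) γ /
                  ENNReal.ofReal (CovShift.effSamples M)))) ∧
        (∀ β : ℝ, 0 ≤ β → CovShift.FourthMomentLower DS β → CovShift.WellSpecified DS wStar σ →
          ∀ J : Set ι, J = {j | 1 / (γ * CovShift.effSamples M) ≤ μ j} →
            c * (ENNReal.ofReal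
                  (CovShift.sqNorm (CovShift.secondMoment DT)
                    (CovShift.contraction (CovShift.stepsize M γ) (CovShift.secondMoment DS) M
                      (w₀ - wStar))) +
                (ENNReal.ofReal β *
                    CovShift.weightedSq v (CovShift.tail μ J) (w₀ - wStar) +
                  ENNReal.ofReal (σ ^ 2)) *
                (CovShift.effDim v μ J (CovShift.secondMoment DT) (CovShift.effSamples M) γ /
                  ENNReal.ofReal (CovShift.effSamples M))) ≤
              ∫⁻ ω, ENNReal.ofReal (CovShift.excessRisk DT wStar
                (CovShift.sgd (CovShift.stepsize M γ) w₀ (fun t => Z t ω) M)) ∂P) := by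
  refine ⟨Real.toNNReal 176, Real.toNNReal (Real.exp (-48) / 4), Real.toNNReal_pos.2 (by norm_num),
    Real.toNNReal_pos.2 (by positivity), ?_⟩
  intro E _ _ _ _ _ _ DS DT _ _ wStar hS2 hT2 hpos hSmin hTmin ι v μ hv α σ h4 hn M hM γ hγ hγα
    Ω _ P Z hZ hi w₀
  have : IsProbabilityMeasure P := (hZ 0 (by omega)).isProbabilityMeasure
  have h := CovShift.isEigenbasis_secondMoment hS2 hpos hv
  obtain ⟨hα, hαT, hγT⟩ := h.stepsize_bounds hS2 h4 hγ hγα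
  exact ⟨CovShift.lintegral_excessRisk_le hZ hi hS2 hSmin h4 hα hn h hM hγ hγT hT2 hTmin hαT w₀,
    fun β hβ hl hw J hJ => CovShift.le_lintegral_excessRisk hZ hi hS2 hSmin h4 hα hn h hM hγ hγT
      hT2 hTmin hl hβ hw w₀ hJ⟩

theorem corollary3 :
    ∃ C c : ℝ≥0, 0 < C ∧ 0 < c ∧
      ∀ (E : Type*) [NormedAddCommGroup E] [InnerProductSpace ℝ E] [CompleteSpace E]
        [SecondCountableTopology E] [MeasurableSpace E] [BorelSpace E]
        (DS DT : Measure (E × ℝ)) [IsProbabilityMeasure DS] [IsProbabilityMeasure DT]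
        (wStar : E) (_ : CovShift.IsCovariateShift DS DT wStar)
        -- an orthonormal eigenbasis of the source covariance, with its eigenvalues
        (ι : Type*) (v : HilbertBasis ι ℝ E) (μ : ι → ℝ)
        (_ : ∀ j, CovShift.secondMoment DS (v j) = μ j • v j)
        (α σ : ℝ) (_ : 0 < α) (_ : 0 < σ)
        (_ : CovShift.FourthMomentUpper DS α) (_ : CovShift.FourthMomentUpper DT α)
        (_ : CovShift.NoiseBound DS wStar σ) (_ : CovShift.NoiseBound DT wStar σ)
        (M : ℕ) (_ : 100 < M)
        (γ : ℝ) (_ : 0 < γ) (_ : γ < 1 / (4 * α * CovShift.trace (CovShift.secondMoment DS)))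
        -- independent source samples
        (Ω : Type*) [MeasurableSpace Ω] (P : Measure Ω) (Z : ℕ → Ω → E × ℝ)
        (_ : ∀ t < M, HasLaw (Z t) DS P) (_ : iIndepFun (fun t : Fin M => Z t) P)
        (w₀ : E),
        (∀ J : Set ι,
          ∫⁻ ω, ENNReal.ofReal (CovShift.excessRisk DT wStar
              (CovShift.sgd (CovShift.stepsize M γ) w₀ (fun t => Z t ω) M)) ∂P ≤
            C * (ENNReal.ofReal
                  (CovShift.sqNorm (CovShift.secondMoment DT)
                    (CovShift.contraction (CovShift.stepsize M γ) (CovShift.secondMoment DS) M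
                      (w₀ - wStar))) +
                (ENNReal.ofReal α *
                    CovShift.weightedSq v
                      (CovShift.headConstTail (1 / (CovShift.effSamples M * γ)) μ J)
                      (w₀ - wStar) +
                  ENNReal.ofReal (σ ^ 2)) *
                (CovShift.effDim v μ J (CovShift.secondMoment DT) (CovShift.effSamples M) γ /
                  ENNReal.ofReal (CovShift.effSamples M)))) ∧
        (∀ β : ℝ, 0 < β →
          CovShift.FourthMomentLower DS β → CovShift.FourthMomentLower DT β →
          CovShift.WellSpecified DS wStar σ → CovShift.WellSpecified DT wStar σ →
          ∀ J : Set ι, J = {j | 1 / (γ * CovShift.effSamples M) ≤ μ j} →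
            c * (ENNReal.ofReal
                  (CovShift.sqNorm (CovShift.secondMoment DT)
                    (CovShift.contraction (CovShift.stepsize M γ) (CovShift.secondMoment DS) M
                      (w₀ - wStar))) +
                (ENNReal.ofReal β *
                    CovShift.weightedSq v (CovShift.tail μ J) (w₀ - wStar) +
                  ENNReal.ofReal (σ ^ 2)) *
                (CovShift.effDim v μ J (CovShift.secondMoment DT) (CovShift.effSamples M) γ /
                  ENNReal.ofReal (CovShift.effSamples M))) ≤
              ∫⁻ ω, ENNReal.ofReal (CovShift.excessRisk DT wStar
                (CovShift.sgd (CovShift.stepsize M γ) w₀ (fun t => Z t ω) M)) ∂P) := by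
  obtain ⟨C, c, hC, hc, hgen⟩ := corollary3_general
  refine ⟨C, c, hC, hc, ?_⟩
  intro E _ _ _ _ _ _ DS DT _ _ wStar hcs ι v μ hv α σ _ _ h4 _ hn _ M hM γ hγ hγα Ω _ P Z hZ hi w₀
  obtain ⟨hupper, hlower⟩ := hgen E DS DT wStar hcs.source_moments hcs.target_moments hcs.source_pos
    hcs.source_min hcs.target_min ι v μ hv α σ h4 hn M (by omega) γ hγ hγα Ω P Z hZ hi w₀
  exact ⟨hupper, fun β hβ hl _ hw _ => hlower β hβ.le hl hw⟩
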